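/- Let $\Omega\subset\mathbb{R}^2$ be a bounded Lipschitz domain with outward unit normal $n$, whose boundary $\Gamma=\partial\Omega$ consists of three pairwise disjoint measurable parts $\Gamma_D,\Gamma_S,\Gamma_T$, i.e. $\Gamma=\overline\Gamma_D\cup\overline\Gamma_S\cup\overline\Gamma_T$ and $\Gamma\setminus(\Gamma_D\cup\Gamma_S\cup\Gamma_T)$ has length zero. Let $\rho,\mu,g,T,c_0>0$, let $\zeta\in C^1(\overline\Omega)$ with $\zeta>0$ on $\overline\Omega$, and put $c(x)=c_0\sqrt{g\zeta(x)}$, $D(u)=\frac12(\nabla u+(\nabla u)^T)$. Let $(\phi,u):\overline\Omega\times[0,T]\to\mathbb{R}\times\mathbb{R}^2$, with $\phi$ of class $C^1$ and $u$ of class $C^2$ on $\overline\Omega\times[0,T]$, satisfy, with $\eta=\phi-\zeta$, $$\frac{\partial\phi}{\partial t}+\nabla\cdot(\phi u)=0,\qquad \rho\phi\Bigl[\frac{\partial u}{\partial t}+(u\cdot\nabla)u\Bigr]-2\mu\nabla\cdot(\phi D(u))+\rho g\phi\nabla\eta=0\qquad\text{in }\Omega\times(0,T),$$ and the boundary conditions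 $u=0$ on $\Gamma_D\times(0,T)$; $(D(u)n)\times n=0$ and $u\cdot n=0$ on $\Gamma_S\times(0,T)$; $u=c\,\frac{\eta}{\phi}\,n$ on $\Gamma_T\times(0,T)$ (the conditions involving $n$ being imposed at the points where $n$ exists). Define $$E(t)=\int_\Omega\frac{\rho}{2}\phi|u|^2\,dx+\int_\Omega\frac{\rho g|\eta|^2}{2}\,dx,\qquad I_1(t;\Gamma_T)=-\frac{\rho}{2}\int_{\Gamma_T}\phi|u|^2\,u\cdot n\,ds,$$ $$I_2(t;\Gamma_T)=-\rho g\int_{\Gamma_T}\phi\,\eta\,u\cdot n\,ds,\qquad I_3(t;\Gamma_T)=2\mu\int_{\Gamma_T}\phi\,[D(u)n]\cdot u\,ds.$$ Suppose that $\phi>0$ on $\overline\Gamma_T\times[0,T]$ and that there is an $\alpha\in(0,1)$ such that $\eta(x,t)\ge-\alpha\zeta(x)$ for all $x\in\overline\Gamma_T$, $t\in[0,T]$, and $$0<c_0\le\sqrt{\tfrac{2}{\alpha}}\,(1-\alpha).$$ Then, for every $t\in[0,T]$, $I_1(t;\Gamma_T)+I_2(t;\Gamma_T)\le0$, and $E$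 is differentiable at $t$ (one-sidedly at $t=0$ and $t=T$); moreover, if the total height satisfies $\phi(\cdot,t)\ge0$ in $\Omega$, then $$\frac{d}{dt}E(t)\le I_3(t;\Gamma_T).$$ -/

import Mathlib

open MeasureTheory Set Filter Topology

namespace SWE

/-- The plane `ℝ²` with its Euclidean structure. -/
abbrev Plane : Type := EuclideanSpace ℝ (Fin 2)

/-- A bounded Lipschitz domain of the plane: a nonempty, connected, bounded open set which, near each
of its boundary points and in suitable orthonormal coordinates, is the region strictly below the
graph of a Lipschitz function. -/
structure IsBoundedLipschitzDomain (Ω : Set Plane) : Prop where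
  isOpen : IsOpen Ω
  isConnected : IsConnected Ω
  isBounded : Bornology.IsBounded Ω
  locally_subgraph : ∀ x ∈ frontier Ω, ∃ (e : Plane ≃ₗᵢ[ℝ] Plane) (γ : ℝ → ℝ) (K : NNReal) (r : ℝ),
    LipschitzWith K γ ∧ 0 < r ∧ ∀ y ∈ Metric.ball x r, (y ∈ Ω ↔ e y 1 < γ (e y 0))

/-- `ν` is the unit outward normal of `Ω` at `x`: to first order at `x`, the set `Ω` is the half plane
`{y | ⟨y - x, ν⟩ < 0}`. For a Lipschitz domain this is the usual normal at each boundary point at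
which the boundary has a tangent, that is, at almost every boundary point. -/
def IsOutwardUnitNormal (Ω : Set Plane) (x ν : Plane) : Prop :=
  ‖ν‖ = 1 ∧ ∀ ε : ℝ, 0 < ε → ∀ᶠ y in 𝓝 x,
    (inner ℝ (y - x) ν < -ε * ‖y - x‖ → y ∈ Ω) ∧ (ε * ‖y - x‖ < inner ℝ (y - x) ν → y ∉ Ω)

/-- There is at most one unit outward normal at a point. -/
theorem IsOutwardUnitNormal.unique {Ω : Set Plane} {x ν ν' : Plane}
    (h : IsOutwardUnitNormal Ω x ν) (h' : IsOutwardUnitNormal Ω x ν') : ν = ν' := by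
  by_contra hne
  have hw : 0 < ‖ν' - ν‖ := norm_pos_iff.2 (sub_ne_zero.2 (Ne.symm hne))
  have h1 : inner ℝ (ν' - ν) ν = -(‖ν' - ν‖ ^ 2 / 2) := by
    rw [@norm_sub_sq_real, inner_sub_left, real_inner_self_eq_norm_sq, h.1, h'.1]; ring
  have h2 : inner ℝ (ν' - ν) ν' = ‖ν' - ν‖ ^ 2 / 2 := by
    rw [@norm_sub_sq_real, inner_sub_left, real_inner_self_eq_norm_sq, h.1, h'.1,
      real_inner_comm]; ring
  have hε : 0 < ‖ν' - ν‖ / 4 := by positivity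
  have hev := (h.2 _ hε).and (h'.2 _ hε)
  have hlim : Tendsto (fun s : ℝ => x + s • (ν' - ν)) (𝓝[>] 0) (𝓝 x) := by
    have hc : Continuous fun s : ℝ => x + s • (ν' - ν) := by fun_prop
    have := (hc.tendsto 0).mono_left (nhdsWithin_le_nhds (s := Ioi 0))
    simpa using this
  obtain ⟨s, hs, hs0⟩ := ((hlim.eventually hev).and self_mem_nhdsWithin).exists
  have hs0 : 0 < s := hs0
  have hpos : 0 < s * ‖ν' - ν‖ ^ 2 := by positivity
  have hsub : x + s • (ν' - ν) - x = s • (ν' - ν) := by abel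
  rw [hsub, norm_smul, Real.norm_of_nonneg hs0.le, real_inner_smul_left, real_inner_smul_left,
    h1, h2] at hs
  exact hs.2.2 (by nlinarith) (hs.1.1 (by nlinarith))

open Classical in
/-- The unit outward normal `n` at `x` (with the value `0` where it does not exist). -/
noncomputable def outwardNormal (Ω : Set Plane) (x : Plane) : Plane :=
  if h : ∃ ν, IsOutwardUnitNormal Ω x ν then h.choose else 0

/-- The line integral `∫_Γ f ds`; the length measure `ds` is the one-dimensional Hausdorff measure. -/
noncomputable def lineIntegral (Γ : Set Plane) (f : Plane → ℝ) : ℝ :=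
  ∫ x in Γ, f x ∂(Measure.hausdorffMeasure 1 : Measure Plane)

/-- The boundary of `Ω` consists of the three non-overlapping parts `ΓD`, `ΓS`, `ΓT`. -/
structure IsBoundaryDecomposition (Ω ΓD ΓS ΓT : Set Plane) : Prop where
  measurable_D : MeasurableSet ΓD
  measurable_S : MeasurableSet ΓS
  measurable_T : MeasurableSet ΓT
  subset_D : ΓD ⊆ frontier Ω
  subset_S : ΓS ⊆ frontier Ω
  subset_T : ΓT ⊆ frontier Ω
  closure_union : frontier Ω = closure ΓD ∪ closure ΓS ∪ closure ΓT
  null_rest : (Measure.hausdorffMeasure 1 : Measure Plane) (frontier Ω \ (ΓD ∪ ΓS ∪ ΓT)) = 0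
  disjoint_DS : Disjoint ΓD ΓS
  disjoint_ST : Disjoint ΓS ΓT
  disjoint_TD : Disjoint ΓT ΓD

/-- The partial derivative `∂f/∂x_i` at `x` of a function `f` on the closed set `closure Ω`. At points
of the open set `Ω` this is the ordinary partial derivative; at boundary points it is the one
determined by the values of `f` on `closure Ω`. -/
noncomputable def pderiv (Ω : Set Plane) (i : Fin 2) (f : Plane → ℝ) (x : Plane) : ℝ :=
  fderivWithin ℝ f (closure Ω) x (EuclideanSpace.single i 1)

/-- The strain-rate tensor `D(v) = (∇v + (∇v)ᵀ) / 2`. -/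
noncomputable def strainRate (Ω : Set Plane) (v : Plane → Plane) (x : Plane) :
    Matrix (Fin 2) (Fin 2) ℝ :=
  fun i j => (pderiv Ω j (fun y => v y i) x + pderiv Ω i (fun y => v y j) x) / 2

/-- The product of a matrix and a vector of the plane. -/
noncomputable def apply (A : Matrix (Fin 2) (Fin 2) ℝ) (w : Plane) : Plane :=
  WithLp.toLp 2 (A.mulVec w)

/-- The (scalar) cross product of two vectors of the plane. -/
def cross (a b : Plane) : ℝ := a 0 * b 1 - a 1 * b 0

/-- The elevation `η = φ - ζ` from the reference height. -/
def elevation (φ : Plane → ℝ → ℝ) (ζ : Plane → ℝ) (x : Plane) (t : ℝ) : ℝ := φ x t - ζ x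

/-- `(φ, u)` is a classical solution, regular up to the boundary, of the shallow water equations
`∂φ/∂t + ∇·(φu) = 0`,
`ρφ[∂u/∂t + (u·∇)u] - 2μ∇·(φD(u)) + ρgφ∇η = 0`, with `φ = η + ζ`, in `Ω × (0, T)`. -/
structure IsSolution (ρ μ g T : ℝ) (Ω : Set Plane) (ζ : Plane → ℝ)
    (φ : Plane → ℝ → ℝ) (u : Plane → ℝ → Plane) : Prop where
  smooth_φ : ContDiffOn ℝ 1 (fun p : Plane × ℝ => φ p.1 p.2) (closure Ω ×ˢ Icc 0 T)
  smooth_u : ContDiffOn ℝ 2 (fun p : Plane × ℝ => u p.1 p.2) (closure Ω ×ˢ Icc 0 T)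
  mass : ∀ x ∈ Ω, ∀ t ∈ Ioo 0 T,
    deriv (fun s => φ x s) t + ∑ j, pderiv Ω j (fun y => φ y t * u y t j) x = 0
  momentum : ∀ x ∈ Ω, ∀ t ∈ Ioo 0 T, ∀ i : Fin 2,
    ρ * φ x t * (deriv (fun s => u x s i) t + ∑ j, u x t j * pderiv Ω j (fun y => u y t i) x)
      - 2 * μ * ∑ j, pderiv Ω j (fun y => φ y t * strainRate Ω (fun z => u z t) y i j) x
      + ρ * g * φ x t * pderiv Ω i (fun y => elevation φ ζ y t) x = 0

/-- The boundary conditions: `u = 0` on `ΓD`; `(D(u)n) × n = 0` and `u · n = 0` on `ΓS`;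
`u = c (η/φ) n` on `ΓT`, with `c = c₀ √(gζ)`. The conditions that involve the normal `n` are imposed
at the points where it exists. -/
structure SatisfiesBoundaryConditions (g T c₀ : ℝ) (Ω ΓD ΓS ΓT : Set Plane) (ζ : Plane → ℝ)
    (φ : Plane → ℝ → ℝ) (u : Plane → ℝ → Plane) : Prop where
  dirichlet : ∀ x ∈ ΓD, ∀ t ∈ Ioo 0 T, u x t = 0
  slip : ∀ x ∈ ΓS, ∀ t ∈ Ioo 0 T, ∀ n, IsOutwardUnitNormal Ω x n →
    cross (apply (strainRate Ω (fun y => u y t) x) n) n = 0 ∧ inner ℝ (u x t) n = 0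
  transmission : ∀ x ∈ ΓT, ∀ t ∈ Ioo 0 T, ∀ n, IsOutwardUnitNormal Ω x n →
    u x t = (c₀ * √(g * ζ x) * (elevation φ ζ x t / φ x t)) • n

/-- The total energy `E(t) = ∫_Ω (ρ/2) φ|u|² dx + ∫_Ω ρg|η|²/2 dx`. -/
noncomputable def energy (ρ g : ℝ) (Ω : Set Plane) (ζ : Plane → ℝ)
    (φ : Plane → ℝ → ℝ) (u : Plane → ℝ → Plane) (t : ℝ) : ℝ :=
  (∫ x in Ω, ρ / 2 * φ x t * ‖u x t‖ ^ 2) + ∫ x in Ω, ρ * g * |elevation φ ζ x t| ^ 2 / 2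

/-- `I₁(t; Γ) = -(ρ/2) ∫_Γ φ|u|² u·n ds`. -/
noncomputable def I₁ (ρ : ℝ) (Ω : Set Plane) (φ : Plane → ℝ → ℝ) (u : Plane → ℝ → Plane)
    (t : ℝ) (Γ : Set Plane) : ℝ :=
  -(ρ / 2) * lineIntegral Γ fun x => φ x t * ‖u x t‖ ^ 2 * inner ℝ (u x t) (outwardNormal Ω x)

/-- `I₂(t; Γ) = -ρg ∫_Γ φη u·n ds`. -/
noncomputable def I₂ (ρ g : ℝ) (Ω : Set Plane) (ζ : Plane → ℝ) (φ : Plane → ℝ → ℝ)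
    (u : Plane → ℝ → Plane) (t : ℝ) (Γ : Set Plane) : ℝ :=
  -(ρ * g) * lineIntegral Γ fun x =>
    φ x t * elevation φ ζ x t * inner ℝ (u x t) (outwardNormal Ω x)

/-- `I₃(t; Γ) = 2μ ∫_Γ φ [D(u)n]·u ds`. -/
noncomputable def I₃ (μ : ℝ) (Ω : Set Plane) (φ : Plane → ℝ → ℝ) (u : Plane → ℝ → Plane)
    (t : ℝ) (Γ : Set Plane) : ℝ :=
  2 * μ * lineIntegral Γ fun x =>
    φ x t * inner ℝ (apply (strainRate Ω (fun y => u y t) x) (outwardNormal Ω x)) (u x t)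

end SWE

open scoped NNReal ENNReal

namespace SWE


/-! ### Length of Lipschitz graphs -/

/-! The proof is an energy estimate. Multiply the mass equation by `ρ|u|²/2 + ρgη`, take the inner
product of the momentum equation with `u`, and add: the time derivative of the energy density equals
the divergence of `energyFlux` minus the dissipation `2μφ|D(u)|²` (`energy_density_balance`).
Integrating over `Ω` turns the divergence into a boundary integral. It vanishes on `ΓD` because `u =
0`, and on `ΓS` because `u·n = 0` while `D(u)n` is parallel to `n`, hence orthogonal to `u`. What
remains on `ΓT` is `I₁ + I₂ + I₃`, and for `φ ≥ 0` the dissipation can be dropped.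

On `ΓT` the transmission condition makes the integrand of `I₁ + I₂` equal to `-(ρ/2) c η² (c²η +
2gφ²) / φ²`. The bracket can be negative only for `η < 0`; then `η ≥ -αζ` and `φ ≥ (1-α)ζ` bound it
below by `gζ²(2(1-α)² - αc₀²)`, which the bound on `c₀` makes nonnegative
(`transmission_flux_nonpos`).

The analytic core is the divergence theorem on a Lipschitz domain with Hausdorff measure as length
(`divergence_theorem`). A partition of unity reduces it to fields supported in one chart, where the
region lies below a Lipschitz graph. There the bulk integral is computed by Fubini along vertical
lines and shifted graphs, and the boundary integral by the length formula `ds = √(1 + γ'²)`; the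
normal exists almost everywhere by Rademacher's theorem. Finally, regularity up to the boundary
carries the equations to all of `closure Ω × [0,T]` and the boundary conditions to the end times, so
that `t = 0` and `t = T` are covered. -/

/-- The reverse triangle inequality for `p + qi` and `p + ri`. It compares chords of a graph with
chords of a line, and also the length densities of two slopes. -/
theorem abs_sqrt_add_sq_sub_le (p q r : ℝ) :
    |√(p ^ 2 + q ^ 2) - √(p ^ 2 + r ^ 2)| ≤ |q - r| := by
  have h := abs_norm_sub_norm_le ((p : ℂ) + q * Complex.I) ((p : ℂ) + r * Complex.I)
  rw [Complex.norm_add_mul_I, Complex.norm_add_mul_I] at h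
  have h2 : ((p : ℂ) + q * Complex.I) - ((p : ℂ) + r * Complex.I) = ((q - r : ℝ) : ℂ) * Complex.I := by
    push_cast; ring
  rw [h2, norm_mul, Complex.norm_I, mul_one, Complex.norm_real] at h
  exact h

set_option linter.unusedSectionVars false

section Graph

variable {X : Type*} [MetricSpace X] [MeasurableSpace X] [BorelSpace X]
  {γ : ℝ → ℝ} {P : ℝ → X}

theorem abs_dist_graph_sub_le
    (hP : ∀ s s', dist (P s) (P s') ^ 2 = (s - s') ^ 2 + (γ s - γ s') ^ 2) {a ε s s' : ℝ}
    (h : |γ s - γ s' - a * (s - s')| ≤ ε * |s - s'|) :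
    |dist (P s) (P s') - √(1 + a ^ 2) * abs (s - s')| ≤ ε * |s - s'| := by
  have h1 : dist (P s) (P s') = √((s - s') ^ 2 + (γ s - γ s') ^ 2) := by
    rw [← hP, Real.sqrt_sq dist_nonneg]
  have h2 : √(1 + a ^ 2) * |s - s'| = √((s - s') ^ 2 + (a * (s - s')) ^ 2) := by
    rw [← Real.sqrt_sq_eq_abs, ← Real.sqrt_mul (by positivity)]
    ring_nf
  rw [h1, h2]
  exact (abs_sqrt_add_sq_sub_le _ _ _).trans h

theorem graph_injective
    (hP : ∀ s s', dist (P s) (P s') ^ 2 = (s - s') ^ 2 + (γ s - γ s') ^ 2) :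
    Function.Injective P := by
  intro s s' h
  have := hP s s'
  rw [h, dist_self] at this
  nlinarith [sq_nonneg (s - s'), sq_nonneg (γ s - γ s')]

/-- Where `γ` is within `ε` of slope `a`, the map `P` is Lipschitz with constant `√(1 + a²) + ε`.
The choice `a = 0`, `ε = K` gives a crude bound valid on every set. -/
theorem hausdorffMeasure_graph_le
    (hP : ∀ s s', dist (P s) (P s') ^ 2 = (s - s') ^ 2 + (γ s - γ s') ^ 2) {a ε : ℝ} {S : Set ℝ}
    (hε : 0 ≤ ε) (h : ∀ s ∈ S, ∀ s' ∈ S, |γ s - γ s' - a * (s - s')| ≤ ε * |s - s'|) :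
    (Measure.hausdorffMeasure 1 : Measure X) (P '' S) ≤
      ENNReal.ofReal (√(1 + a ^ 2) + ε) * volume S := by
  have hL : LipschitzOnWith (Real.toNNReal (√(1 + a ^ 2) + ε)) P S := by
    refine LipschitzOnWith.of_dist_le_mul fun s hs s' hs' => ?_
    rw [Real.coe_toNNReal _ (by positivity), Real.dist_eq]
    have := (abs_le.1 (abs_dist_graph_sub_le hP (h s hs s' hs'))).2
    linarith
  have := hL.hausdorffMeasure_image_le (d := 1) zero_le_one
  rw [hausdorffMeasure_real, ENNReal.rpow_one] at this
  exact this

/-- The inverse of `P` is Lipschitz with constant `(√(1 + a²) - ε)⁻¹`; the condition `ε < 1` keeps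
this positive. -/
theorem le_hausdorffMeasure_graph
    (hP : ∀ s s', dist (P s) (P s') ^ 2 = (s - s') ^ 2 + (γ s - γ s') ^ 2) {a ε : ℝ} {S : Set ℝ}
    (hε : ε < 1) (h : ∀ s ∈ S, ∀ s' ∈ S, |γ s - γ s' - a * (s - s')| ≤ ε * |s - s'|) :
    ENNReal.ofReal (√(1 + a ^ 2) - ε) * volume S ≤
      (Measure.hausdorffMeasure 1 : Measure X) (P '' S) := by
  have hw : 1 ≤ √(1 + a ^ 2) := Real.one_le_sqrt.2 (by nlinarith [sq_nonneg a])
  have hpos : 0 < √(1 + a ^ 2) - ε := by linarith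
  have hinj := graph_injective hP
  have hL : LipschitzOnWith (Real.toNNReal (√(1 + a ^ 2) - ε)⁻¹) (Function.invFun P) (P '' S) := by
    refine LipschitzOnWith.of_dist_le_mul ?_
    rintro _ ⟨s, hs, rfl⟩ _ ⟨s', hs', rfl⟩
    rw [Function.leftInverse_invFun hinj s, Function.leftInverse_invFun hinj s',
      Real.coe_toNNReal _ (by positivity), Real.dist_eq, inv_mul_eq_div, le_div_iff₀ hpos]
    have := (abs_le.1 (abs_dist_graph_sub_le hP (h s hs s' hs'))).1
    linarith
  have := hL.hausdorffMeasure_image_le (d := 1) zero_le_one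
  rw [hausdorffMeasure_real, ENNReal.rpow_one, image_image] at this
  simp only [Function.leftInverse_invFun hinj _, image_id'] at this
  have h3 : ((Real.toNNReal (√(1 + a ^ 2) - ε)⁻¹ : ℝ≥0) : ℝ≥0∞)
      = (ENNReal.ofReal (√(1 + a ^ 2) - ε))⁻¹ := by
    rw [← ENNReal.ofReal_inv_of_pos hpos]; rfl
  rw [h3] at this
  calc _ ≤ ENNReal.ofReal (√(1 + a ^ 2) - ε) * _ := mul_le_mul_right this _
    _ = _ := by
      rw [← mul_assoc, ENNReal.mul_inv_cancel (by simpa using hpos) ENNReal.ofReal_ne_top, one_mul]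

theorem graph_isClosedEmbedding {K : ℝ≥0} (hγ : LipschitzWith K γ)
    (hP : ∀ s s', dist (P s) (P s') ^ 2 = (s - s') ^ 2 + (γ s - γ s') ^ 2) :
    IsClosedEmbedding P := by
  have hL : LipschitzWith (1 + K) P := by
    refine LipschitzWith.of_dist_le_mul fun s s' => ?_
    have h1 := hγ.dist_le_mul s s'
    rw [Real.dist_eq, Real.dist_eq] at h1
    rw [Real.dist_eq]
    refine abs_le_of_sq_le_sq' ?_ (by positivity) |>.2
    rw [hP]
    push_cast
    have h2 : (γ s - γ s') ^ 2 ≤ (K * |s - s'|) ^ 2 := sq_le_sq' (by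
      linarith [neg_abs_le (γ s - γ s')]) (by linarith [le_abs_self (γ s - γ s')])
    have h3 : (s - s') ^ 2 = |s - s'| ^ 2 := (sq_abs _).symm
    have : 0 ≤ (K : ℝ) * |s - s'| ^ 2 := by positivity
    nlinarith
  have hA : AntilipschitzWith 1 P := by
    refine AntilipschitzWith.of_le_mul_dist fun s s' => ?_
    rw [NNReal.coe_one, one_mul, Real.dist_eq]
    refine abs_le_of_sq_le_sq ?_ dist_nonneg
    rw [hP]; nlinarith [sq_nonneg (γ s - γ s')]
  exact hA.isClosedEmbedding hL.uniformContinuous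

/-- The length of the piece of a Lipschitz graph over a measurable set. -/
theorem hausdorffMeasure_graph {K : ℝ≥0} (hγ : LipschitzWith K γ)
    (hP : ∀ s s', dist (P s) (P s') ^ 2 = (s - s') ^ 2 + (γ s - γ s') ^ 2)
    {A : Set ℝ} (hA : MeasurableSet A) (hfin : volume A ≠ ∞) :
    (Measure.hausdorffMeasure 1 : Measure X) (P '' A) =
      ∫⁻ s in A, ENNReal.ofReal √(1 + deriv γ s ^ 2) := by
  have hemb := (graph_isClosedEmbedding hγ hP).measurableEmbedding
  set N : Set ℝ := {s | ¬ DifferentiableAt ℝ γ s} with hN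
  have hN0 : volume N = 0 := hγ.ae_differentiableAt
  have hmeas : MeasurableSet Nᶜ := by
    have := measurableSet_of_differentiableAt ℝ γ
    simpa [hN, compl_ofPred] using this
  set w : ℝ → ℝ := fun s => √(1 + deriv γ s ^ 2) with hw
  have hwm : Measurable w := by
    have := measurable_deriv γ
    fun_prop
  set ν : Measure ℝ := (Measure.hausdorffMeasure 1 : Measure X).comap P with hν
  have hνa : ∀ S, MeasurableSet S → ν S = (Measure.hausdorffMeasure 1 : Measure X) (P '' S) :=
    fun S hS => hemb.comap_apply _ S
  -- The points of nondifferentiability form a null set, and a Lipschitz map sends it to a set of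
  -- length zero.
  have hνN : ν Nᶜᶜ = 0 := by
    rw [hνa _ hmeas.compl, compl_compl]
    have := hausdorffMeasure_graph_le hP (a := 0) (ε := K) (S := N) K.2 (fun s _ s' _ => by
      simpa [Real.dist_eq] using hγ.dist_le_mul s s')
    rw [hN0, mul_zero] at this
    exact le_antisymm this bot_le
  -- the two inequalities up to `ε`
  have key : ∀ ε : ℝ≥0, 0 < ε → ε < 1 →
      ν A ≤ (∫⁻ s in A, ENNReal.ofReal (w s)) + 2 * ε * volume A ∧
      (∫⁻ s in A, ENNReal.ofReal (w s)) ≤ ν A + 2 * ε * volume A := by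
    intro ε hε hε1
    -- The differentiability set is covered by countably many disjoint pieces on each of which `γ`
    -- is `ε`-close to a linear map of slope `B n 1`. The two length estimates apply piece by piece
    -- and are summed.
    obtain ⟨t, B, htd, htm, htc, hta, -⟩ := exists_partition_approximatesLinearOn_of_hasFDerivWithinAt
      γ Nᶜ (fun s => fderiv ℝ γ s) (fun x hx => by
        have hx' : DifferentiableAt ℝ γ x := by simpa [hN] using hx
        exact hx'.hasFDerivAt.hasFDerivWithinAt) (fun _ => ε) (fun _ => hε.ne')
    set S : ℕ → Set ℝ := fun n => A ∩ (Nᶜ ∩ t n) with hS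
    have hSm : ∀ n, MeasurableSet (S n) := fun n => hA.inter (hmeas.inter (htm n))
    have hSd : Pairwise (Function.onFun Disjoint S) := fun i j hij =>
      (htd hij).mono (fun x hx => hx.2.2) (fun x hx => hx.2.2)
    have hSU : ⋃ n, S n = A ∩ Nᶜ := by
      ext x; constructor
      · intro hx; obtain ⟨n, hn⟩ := mem_iUnion.1 hx; exact ⟨hn.1, hn.2.1⟩
      · intro hx; obtain ⟨n, hn⟩ := mem_iUnion.1 (htc hx.2); exact mem_iUnion.2 ⟨n, hx.1, hx.2, hn⟩
    have sumS : ∀ m : Measure ℝ, m Nᶜᶜ = 0 → m A = ∑' n, m (S n) := by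
      intro m hm
      rw [← measure_iUnion hSd hSm, hSU]
      exact (measure_inter_conull' (by
        refine measure_mono_null (fun x hx => hx.2) hm)).symm
    have hlin : ∀ n, ∀ s ∈ S n, ∀ s' ∈ S n,
        |γ s - γ s' - B n 1 * (s - s')| ≤ ε * |s - s'| := by
      intro n s hs s' hs'
      have := hta n s hs.2 s' hs'.2
      have e : B n (s - s') = B n 1 * (s - s') := by
        conv_lhs => rw [show s - s' = (s - s') • (1 : ℝ) by simp]
        rw [map_smul, smul_eq_mul, mul_comm]
      rw [e] at this
      exact this
    have hder : ∀ n, ∀ᵐ s ∂(volume.restrict (S n)), |w s - √(1 + (B n 1) ^ 2)| ≤ ε := by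
      intro n
      have := ((hta n).mono_set (fun x hx => hx.2 : S n ⊆ _)).norm_fderiv_sub_le volume (hSm n)
        (fun s => fderiv ℝ γ s) (fun x hx => by
        have hx' : DifferentiableAt ℝ γ x := by simpa [hN] using hx.2.1
        exact hx'.hasFDerivAt.hasFDerivWithinAt)
      filter_upwards [this] with s hs
      have h1 : |deriv γ s - B n 1| ≤ ε := by
        have := (fderiv ℝ γ s - B n).le_opNorm 1
        simp only [norm_one, mul_one] at this
        refine le_trans ?_ (this.trans hs)
        rw [← fderiv_apply_one_eq_deriv]; rfl
      have h2 := abs_sqrt_add_sq_sub_le 1 (deriv γ s) (B n 1)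
      rw [one_pow] at h2
      exact h2.trans h1
    have hpos : ∀ n, (1 : ℝ) ≤ √(1 + (B n 1) ^ 2) := fun n =>
      Real.one_le_sqrt.2 (by nlinarith [sq_nonneg (B n 1)])
    have hε2 : ((ε : ℝ≥0) : ℝ≥0∞) = ENNReal.ofReal ε := (ENNReal.ofReal_coe_nnreal).symm
    have h22 : (2 : ℝ≥0∞) = ENNReal.ofReal 2 := by simp
    have hvol : volume A = ∑' n, volume (S n) := sumS volume (by simpa using hN0)
    have hwi : (∫⁻ s in A, ENNReal.ofReal (w s)) = ∑' n, ∫⁻ s in S n, ENNReal.ofReal (w s) := by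
      have := sumS (volume.withDensity fun s => ENNReal.ofReal (w s))
        (withDensity_absolutelyContinuous _ _ (by simpa using hN0))
      rw [withDensity_apply _ hA] at this
      simpa [withDensity_apply _ (hSm _)] using this
    rw [hwi, hvol, sumS ν hνN, ← ENNReal.tsum_mul_left, ← ENNReal.tsum_add, ← ENNReal.tsum_add]
    constructor
    · refine ENNReal.tsum_le_tsum fun n => ?_
      rw [hνa _ (hSm n)]
      refine (hausdorffMeasure_graph_le hP ε.coe_nonneg (hlin n)).trans ?_
      rw [← setLIntegral_const, ← setLIntegral_const, ← lintegral_add_right _ measurable_const]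
      refine lintegral_mono_ae ?_
      filter_upwards [hder n] with s hs
      rw [hε2, h22, ← ENNReal.ofReal_mul (by norm_num),
        ← ENNReal.ofReal_add (Real.sqrt_nonneg _) (by positivity)]
      refine ENNReal.ofReal_le_ofReal ?_
      have := (abs_le.1 hs).1
      change _ ≤ w s + _
      linarith
    · refine ENNReal.tsum_le_tsum fun n => ?_
      rw [hνa _ (hSm n)]
      refine le_trans ?_ (add_le_add_left (le_hausdorffMeasure_graph hP (NNReal.coe_lt_one.2 hε1) (hlin n)) _)
      rw [← setLIntegral_const, ← setLIntegral_const, ← lintegral_add_right _ measurable_const]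
      refine lintegral_mono_ae ?_
      filter_upwards [hder n] with s hs
      rw [hε2, h22, ← ENNReal.ofReal_mul (by norm_num),
        ← ENNReal.ofReal_add (by
          have := hpos n
          have : (ε : ℝ) < 1 := hε1
          linarith) (by positivity)]
      refine ENNReal.ofReal_le_ofReal ?_
      have := (abs_le.1 hs).2
      linarith
  -- The values `1 / (n + 2)` are strictly below `1`, as the lower estimate requires; finiteness of
  -- `volume A` makes the error vanish.
  have hlim : Tendsto (fun n : ℕ => 2 * (((1 / ((n : ℝ≥0) + 2) : ℝ≥0)) : ℝ≥0∞) * volume A) atTop (𝓝 0) := by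
    have h1 : Tendsto (fun n : ℕ => (1 / ((n : ℝ≥0) + 2) : ℝ≥0)) atTop (𝓝 0) := by
      rw [← NNReal.tendsto_coe]
      have := (tendsto_add_atTop_iff_nat 2).2 (tendsto_inv_atTop_nhds_zero_nat (𝕜 := ℝ))
      simpa using this
    have h2 := ENNReal.tendsto_coe.2 h1
    have h3 := ENNReal.Tendsto.mul_const (ENNReal.Tendsto.const_mul h2 (a := 2) (Or.inr (by simp)))
      (b := volume A) (Or.inr hfin)
    simpa using h3
  have hk : ∀ n : ℕ, 0 < (1 / ((n : ℝ≥0) + 2) : ℝ≥0) ∧ (1 / ((n : ℝ≥0) + 2) : ℝ≥0) < 1 := by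
    intro n
    refine ⟨by positivity, ?_⟩
    rw [div_lt_one (by positivity)]
    calc (1 : ℝ≥0) < 2 := one_lt_two
      _ ≤ n + 2 := le_add_of_nonneg_left bot_le
  rw [← hνa A hA]
  refine le_antisymm ?_ ?_
  · refine ge_of_tendsto' (x := atTop) (f := fun n : ℕ => (∫⁻ s in A, ENNReal.ofReal (w s)) +
      2 * (((1 / ((n : ℝ≥0) + 2) : ℝ≥0)) : ℝ≥0∞) * volume A) ?_ fun n =>
      (key _ (hk n).1 (hk n).2).1
    simpa using tendsto_const_nhds.add hlim
  · refine ge_of_tendsto' (x := atTop) (f := fun n : ℕ => ν A +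
      2 * (((1 / ((n : ℝ≥0) + 2) : ℝ≥0)) : ℝ≥0∞) * volume A) ?_ fun n =>
      (key _ (hk n).1 (hk n).2).2
    simpa using tendsto_const_nhds.add hlim

/-- The length measure on a Lipschitz graph, in the coordinate of the graph. -/
theorem hausdorffMeasure_restrict_graph {K : ℝ≥0} (hγ : LipschitzWith K γ)
    (hP : ∀ s s', dist (P s) (P s') ^ 2 = (s - s') ^ 2 + (γ s - γ s') ^ 2) :
    (Measure.hausdorffMeasure 1 : Measure X).restrict (range P) =
      (volume.withDensity fun s => ENNReal.ofReal √(1 + deriv γ s ^ 2)).map P := by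
  have hemb := (graph_isClosedEmbedding hγ hP).measurableEmbedding
  rw [← hemb.map_comap]
  congr 1
  have happ : ∀ ⦃a b : ℝ⦄, a < b →
      (Measure.hausdorffMeasure 1 : Measure X).comap P (Ioc a b) =
      (volume.withDensity fun s => ENNReal.ofReal √(1 + deriv γ s ^ 2)) (Ioc a b) := by
    intro a b _
    rw [hemb.comap_apply, withDensity_apply _ measurableSet_Ioc,
      hausdorffMeasure_graph hγ hP measurableSet_Ioc (by simp)]
  -- Half-open intervals determine the measure once they have finite mass, and the crude Lipschitz
  -- bound supplies that.
  refine Measure.ext_of_Ioc' _ _ (fun a b _ => ?_) happ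
  rw [hemb.comap_apply]
  have := hausdorffMeasure_graph_le hP (a := 0) (ε := K) (S := Ioc a b) K.2 (fun s _ s' _ => by
      simpa [Real.dist_eq] using hγ.dist_le_mul s s')
  refine (this.trans_lt ?_).ne
  exact ENNReal.mul_lt_top ENNReal.ofReal_lt_top (by simp)

end Graph


/-! ### The divergence theorem below a Lipschitz graph -/

section Subgraph

variable {γ : ℝ → ℝ} {K : ℝ≥0} {f : ℝ × ℝ → ℝ} {f' : ℝ × ℝ → ℝ × ℝ →L[ℝ] ℝ} {M R : ℝ}

theorem isOpen_subgraph (hγ : Continuous γ) : IsOpen {p : ℝ × ℝ | p.2 < γ p.1} :=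
  isOpen_lt continuous_snd (hγ.comp continuous_fst)

/-- The integrand is bounded and vanishes off a ball. The weight `w` is there to be `deriv γ`, which
is only measurable and bounded. -/
theorem integrableOn_subgraph (hγ : Continuous γ)
    (hc' : ContinuousOn f' {p | p.2 < γ p.1}) (hM : ∀ p : ℝ × ℝ, p.2 < γ p.1 → ‖f' p‖ ≤ M)
    (hR : ∀ p, R ≤ ‖p‖ → f p = 0 ∧ f' p = 0) {w : ℝ → ℝ} (hw : Measurable w) {C : ℝ}
    (hC : ∀ s, |w s| ≤ C) (v : ℝ × ℝ) :
    IntegrableOn (fun p => w p.1 * f' p v) {p | p.2 < γ p.1} := by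
  have hUm := (isOpen_subgraph hγ).measurableSet
  have hmeas : AEStronglyMeasurable (fun p : ℝ × ℝ => w p.1 * f' p v)
      (volume.restrict {p | p.2 < γ p.1}) := by
    refine (hw.comp measurable_fst).aestronglyMeasurable.mul ?_
    exact (hc'.clm_apply continuousOn_const).aestronglyMeasurable hUm
  have h1 : IntegrableOn (fun p => w p.1 * f' p v) ({p | p.2 < γ p.1} ∩ Metric.ball 0 R) := by
    refine IntegrableOn.of_bound ?_ ?_ (C * (M * ‖v‖)) ?_
    · exact ((measure_mono inter_subset_right).trans_lt Metric.isBounded_ball.measure_lt_top)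
    · exact hmeas.mono_measure (Measure.restrict_mono inter_subset_left le_rfl)
    · refine (ae_restrict_iff' (hUm.inter Metric.isOpen_ball.measurableSet)).2
        (Eventually.of_forall fun p hp => ?_)
      rw [norm_mul]
      have hC0 : 0 ≤ C := (abs_nonneg _).trans (hC 0)
      exact mul_le_mul (hC _) (((f' p).le_opNorm v).trans (by gcongr; exact hM p hp.1))
        (norm_nonneg _) hC0
  refine h1.of_forall_sdiff_eq_zero hUm fun p hp => ?_
  have : R ≤ ‖p‖ := by
    by_contra hlt
    exact hp.2 ⟨hp.1, by simpa using hlt⟩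
  simp [(hR p this).2]

/-- Fubini, and on each vertical ray the fundamental theorem of calculus: `f` vanishes far below and
is continuous up to the graph. -/
theorem integral_subgraph_vertical (hγ : Continuous γ)
    (hcont : ContinuousOn f {p | p.2 ≤ γ p.1})
    (hd : ∀ p : ℝ × ℝ, p.2 < γ p.1 → HasFDerivAt f (f' p) p)
    (hc' : ContinuousOn f' {p | p.2 < γ p.1}) (hM : ∀ p : ℝ × ℝ, p.2 < γ p.1 → ‖f' p‖ ≤ M)
    (hR : ∀ p, R ≤ ‖p‖ → f p = 0 ∧ f' p = 0) {w : ℝ → ℝ} (hw : Measurable w) {C : ℝ}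
    (hC : ∀ s, |w s| ≤ C) :
    ∫ p in {p : ℝ × ℝ | p.2 < γ p.1}, w p.1 * f' p (0, 1) = ∫ s, w s * f (s, γ s) := by
  have hUm := (isOpen_subgraph hγ).measurableSet
  have hint := integrableOn_subgraph hγ hc' hM hR hw hC (0, 1)
  rw [← integral_indicator hUm, Measure.volume_eq_prod, integral_prod _ (by
    rw [← Measure.volume_eq_prod]; exact hint.integrable_indicator hUm)]
  congr 1
  ext s
  have h1 : ∀ τ, indicator {p : ℝ × ℝ | p.2 < γ p.1} (fun p => w p.1 * f' p (0, 1)) (s, τ) =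
      indicator (Iio (γ s)) (fun τ => w s * f' (s, τ) (0, 1)) τ := fun τ => rfl
  simp only [h1]
  rw [integral_indicator measurableSet_Iio, ← integral_Iic_eq_integral_Iio, integral_const_mul]
  congr 1
  have hslice : ContinuousOn (fun τ => f' (s, τ) (0, 1)) (Iio (γ s)) :=
    (hc'.comp (f := fun τ => (s, τ)) (by fun_prop) (fun τ hτ => hτ)).clm_apply continuousOn_const
  have hzero : ∀ τ, R ≤ |τ| → f (s, τ) = 0 ∧ f' (s, τ) = 0 := fun τ hτ =>
    hR _ (hτ.trans (le_max_right ‖s‖ ‖τ‖))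
  have hi : IntegrableOn (fun τ => f' (s, τ) (0, 1)) (Iic (γ s)) := by
    rw [integrableOn_Iic_iff_integrableOn_Iio]
    have h1 : IntegrableOn (fun τ => f' (s, τ) (0, 1)) (Iio (γ s) ∩ Metric.ball 0 R) := by
      refine IntegrableOn.of_bound ?_ ?_ (M * ‖((0 : ℝ), (1 : ℝ))‖) ?_
      · exact ((measure_mono inter_subset_right).trans_lt Metric.isBounded_ball.measure_lt_top)
      · exact (hslice.mono inter_subset_left).aestronglyMeasurable
          (measurableSet_Iio.inter Metric.isOpen_ball.measurableSet)
      · refine (ae_restrict_iff' (measurableSet_Iio.inter Metric.isOpen_ball.measurableSet)).2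
          (Eventually.of_forall fun p hp => ?_)
        exact ((f' (s, p)).le_opNorm _).trans (by gcongr; exact hM (s, p) hp.1)
    refine h1.of_forall_sdiff_eq_zero measurableSet_Iio fun p hp => ?_
    have : R ≤ |p| := by
      by_contra hlt
      exact hp.2 ⟨hp.1, by simpa using hlt⟩
    simp [(hzero p this).2]
  have := integral_Iic_of_hasDerivAt_of_tendsto (f := fun τ => f (s, τ))
    (f' := fun τ => f' (s, τ) (0, 1)) (a := γ s) (m := 0) ?_ ?_ hi ?_
  · rw [this, sub_zero]
  · exact (hcont (s, γ s) (le_refl (γ s))).comp (by fun_prop) (fun τ hτ => hτ)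
  · intro τ hτ
    exact (hd (s, τ) hτ).comp_hasDerivAt τ ((hasDerivAt_const τ s).prodMk (hasDerivAt_id τ))
  · refine tendsto_const_nhds.congr' ?_
    filter_upwards [eventually_le_atBot (-R)] with τ hτ
    exact (hzero τ (le_trans (by linarith) (neg_le_abs τ))).1.symm

/-- Lowering the graph by `-σ > 0` puts it in the open region, where `f` is `C¹`. Along this curve
`f` is Lipschitz on `[-|R|, |R|]`, hence absolutely continuous, and zero at both ends; the integrand
is its derivative almost everywhere. -/
theorem integral_shifted_graph_eq_zero (hγ : LipschitzWith K γ)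
    (hd : ∀ p : ℝ × ℝ, p.2 < γ p.1 → HasFDerivAt f (f' p) p)
    (hc' : ContinuousOn f' {p | p.2 < γ p.1})
    (hR : ∀ p, R ≤ ‖p‖ → f p = 0 ∧ f' p = 0) {σ : ℝ} (hσ : σ < 0) :
    ∫ s, f' (s, σ + γ s) (1, deriv γ s) = 0 := by
  have hcL : LipschitzWith (max 1 K) (fun s => ((s, σ + γ s) : ℝ × ℝ)) := by
    refine LipschitzWith.id.prodMk ?_
    refine LipschitzWith.of_dist_le_mul fun x y => ?_
    simpa using hγ.dist_le_mul x y
  have hmem : ∀ s, ((s, σ + γ s) : ℝ × ℝ) ∈ {p : ℝ × ℝ | p.2 < γ p.1} := fun s => by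
    change σ + γ s < γ s
    linarith
  have hloc : LocallyLipschitz fun s => f (s, σ + γ s) := by
    intro s
    have hst : HasStrictFDerivAt f (f' (s, σ + γ s)) (s, σ + γ s) := by
      refine hasStrictFDerivAt_of_hasFDerivAt_of_continuousAt ?_
        (hc'.continuousAt ((isOpen_subgraph hγ.continuous).mem_nhds (hmem s)))
      filter_upwards [(isOpen_subgraph hγ.continuous).mem_nhds (hmem s)] with p hp using hd p hp
    obtain ⟨L, V, hV, hL⟩ := hst.exists_lipschitzOnWith
    exact ⟨L * max 1 K, _, hcL.continuous.continuousAt.preimage_mem_nhds hV,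
      hL.comp hcL.lipschitzOnWith (fun x hx => hx)⟩
  obtain ⟨L, hL⟩ := (hloc.locallyLipschitzOn (s := uIcc (-|R|) |R|)).exists_lipschitzOnWith_of_compact
    isCompact_uIcc
  have hac := hL.absolutelyContinuousOnInterval.integral_deriv_eq_sub
  have hnorm : ∀ s : ℝ, |R| ≤ |s| → R ≤ ‖((s, σ + γ s) : ℝ × ℝ)‖ := fun s hs =>
    ((le_abs_self R).trans hs).trans (le_max_left ‖s‖ _)
  rw [(hR _ (hnorm |R| (by simp))).1, (hR _ (hnorm (-|R|) (by simp))).1, sub_zero] at hac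
  have hder : ∀ᵐ s, deriv (fun s => f (s, σ + γ s)) s = f' (s, σ + γ s) (1, deriv γ s) := by
    filter_upwards [hγ.ae_differentiableAt] with s hs
    exact ((hd _ (hmem s)).comp_hasDerivAt s
      ((hasDerivAt_id s).prodMk (hs.hasDerivAt.const_add σ))).deriv
  rw [intervalIntegral.integral_of_le (by linarith [abs_nonneg R])] at hac
  rw [← hac, setIntegral_congr_ae (g := fun s => f' (s, σ + γ s) (1, deriv γ s))
    measurableSet_Ioc (hder.mono fun s hs _ => hs)]
  refine (setIntegral_eq_integral_of_forall_compl_eq_zero fun s hs => ?_).symm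
  have : |R| ≤ |s| := by
    by_contra hlt
    rw [not_le, abs_lt] at hlt
    exact hs ⟨hlt.1, hlt.2.le⟩
  simp [(hR _ (hnorm s this)).2]

/-- Horizontal slices of the region can be wild. Adding `deriv γ` times the vertical derivative,
whose integral is known, gives the derivative along the tangent `(1, deriv γ)`. After the
measure-preserving shear `(s, σ) ↦ (s, σ + γ s)`, Fubini leaves one vanishing integral for each
shifted graph. -/
theorem integral_subgraph_horizontal (hγ : LipschitzWith K γ)
    (hcont : ContinuousOn f {p | p.2 ≤ γ p.1})
    (hd : ∀ p : ℝ × ℝ, p.2 < γ p.1 → HasFDerivAt f (f' p) p)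
    (hc' : ContinuousOn f' {p | p.2 < γ p.1}) (hM : ∀ p : ℝ × ℝ, p.2 < γ p.1 → ‖f' p‖ ≤ M)
    (hR : ∀ p, R ≤ ‖p‖ → f p = 0 ∧ f' p = 0) :
    ∫ p in {p : ℝ × ℝ | p.2 < γ p.1}, f' p (1, 0) = -∫ s, deriv γ s * f (s, γ s) := by
  have hUm := (isOpen_subgraph hγ.continuous).measurableSet
  have hdb : ∀ s, |deriv γ s| ≤ K := fun s => norm_deriv_le_of_lipschitz hγ
  have hi1 := integrableOn_subgraph hγ.continuous hc' hM hR (w := fun _ => 1) measurable_const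
    (C := 1) (by simp) (1, 0)
  simp only [one_mul] at hi1
  have hi2 := integrableOn_subgraph hγ.continuous hc' hM hR (measurable_deriv γ) hdb (0, 1)
  rw [← integral_subgraph_vertical hγ.continuous hcont hd hc' hM hR (measurable_deriv γ) hdb,
    eq_neg_iff_add_eq_zero, ← integral_add hi1 hi2]
  set H : ℝ × ℝ → ℝ := fun p => f' p (1, deriv γ p.1) with hH
  have hHe : ∀ p : ℝ × ℝ, f' p (1, 0) + deriv γ p.1 * f' p (0, 1) = H p := by
    intro p
    have : ((1 : ℝ), deriv γ p.1) = (1, 0) + deriv γ p.1 • ((0 : ℝ), (1 : ℝ)) := by simp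
    rw [hH]; dsimp only
    rw [this, map_add, map_smul, smul_eq_mul]
  simp only [hHe]
  have hiH : IntegrableOn H {p : ℝ × ℝ | p.2 < γ p.1} := by
    have := hi1.add hi2
    exact this.congr (Eventually.of_forall hHe)
  set G := indicator {p : ℝ × ℝ | p.2 < γ p.1} H with hG
  have hiG : Integrable G := hiH.integrable_indicator hUm
  rw [← integral_indicator hUm, ← hG]
  have hshear : MeasurePreserving (fun p : ℝ × ℝ => (p.1, p.2 + γ p.1)) := by
    have := MeasurePreserving.skew_product (MeasurePreserving.id (volume : Measure ℝ))
      (g := fun s τ => τ + γ s) (μc := (volume : Measure ℝ)) (μd := volume)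
      (by have := hγ.continuous; unfold Function.uncurry; fun_prop)
      (Eventually.of_forall fun s => map_add_right_eq_self _ _)
    exact this
  have hiS : Integrable (fun p : ℝ × ℝ => G (p.1, p.2 + γ p.1)) :=
    hshear.integrable_comp_of_integrable hiG
  calc ∫ p, G p = ∫ s, ∫ τ, G (s, τ) := by
        rw [Measure.volume_eq_prod] at hiG ⊢; exact integral_prod _ hiG
    _ = ∫ s, ∫ σ, G (s, σ + γ s) := by
        congr 1; ext s
        exact (integral_add_right_eq_self (fun τ => G (s, τ)) (γ s)).symm
    _ = ∫ σ, ∫ s, G (s, σ + γ s) := by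
        rw [Measure.volume_eq_prod] at hiS
        exact integral_integral_swap hiS
    _ = ∫ σ, (0 : ℝ) := by
        congr 1; ext σ
        by_cases hσ : σ < 0
        · rw [← integral_shifted_graph_eq_zero hγ hd hc' hR hσ]
          congr 1; ext s
          exact indicator_of_mem (by change σ + γ s < γ s; linarith) _
        · rw [← integral_zero ℝ ℝ]
          congr 1; ext s
          exact indicator_of_notMem (by change ¬ (σ + γ s < γ s); linarith) _
    _ = 0 := integral_zero _ _

end Subgraph


/-! ### Local charts of a Lipschitz domain -/

theorem outwardNormal_eq {Ω : Set Plane} {x ν : Plane} (h : IsOutwardUnitNormal Ω x ν) :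
    outwardNormal Ω x = ν := by
  have hex : ∃ ν, IsOutwardUnitNormal Ω x ν := ⟨ν, h⟩
  rw [outwardNormal, dif_pos hex]
  exact hex.choose_spec.unique h

theorem inner_plane (a b : Plane) : inner ℝ a b = a 0 * b 0 + a 1 * b 1 := by
  simp [PiLp.inner_apply, Fin.sum_univ_two, mul_comm]

theorem abs_apply_le_norm (a : Plane) (i : Fin 2) : |a i| ≤ ‖a‖ := PiLp.norm_apply_le a i

/-- In the orthonormal coordinates given by `e`, the set `Ω` is near `x` the region strictly below
the graph of the Lipschitz function `γ`. -/
structure IsChart (Ω : Set Plane) (x : Plane) (e : Plane ≃ₗᵢ[ℝ] Plane) (γ : ℝ → ℝ) (K : ℝ≥0)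
    (r : ℝ) : Prop where
  lipschitz : LipschitzWith K γ
  pos : 0 < r
  mem_iff : ∀ y ∈ Metric.ball x r, (y ∈ Ω ↔ e y 1 < γ (e y 0))

theorem IsBoundedLipschitzDomain.exists_chart {Ω : Set Plane} (hΩ : IsBoundedLipschitzDomain Ω)
    {x : Plane} (hx : x ∈ closure Ω) : ∃ e γ K r, IsChart Ω x e γ K r := by
  by_cases hxΩ : x ∈ Ω
  · obtain ⟨r, hr, hsub⟩ := Metric.isOpen_iff.1 hΩ.isOpen x hxΩ
    -- At an interior point any graph above the ball will do; a ball of radius `r` stays below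
    -- height `x 1 + r`.
    refine ⟨LinearIsometryEquiv.refl ℝ Plane, fun _ => x 1 + r, 0, r, LipschitzWith.const _, hr,
      fun y hy => iff_of_true (hsub hy) ?_⟩
    have h1 := abs_apply_le_norm (y - x) 1
    rw [Metric.mem_ball, dist_eq_norm] at hy
    have h2 := le_abs_self ((y - x) 1)
    simp only [PiLp.sub_apply] at h1 h2
    change y 1 < x 1 + r
    linarith
  · obtain ⟨e, γ, K, r, h1, h2, h3⟩ := hΩ.locally_subgraph x
      (by rw [hΩ.isOpen.frontier_eq]; exact ⟨hx, hxΩ⟩)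
    exact ⟨e, γ, K, r, h1, h2, h3⟩

section Chart

variable {Ω : Set Plane} {x : Plane} {e : Plane ≃ₗᵢ[ℝ] Plane} {γ : ℝ → ℝ} {K : ℝ≥0} {r : ℝ}

theorem IsChart.mem_closure_iff (h : IsChart Ω x e γ K r) {y : Plane} (hy : y ∈ Metric.ball x r) :
    y ∈ closure Ω ↔ e y 1 ≤ γ (e y 0) := by
  have hγ := h.lipschitz.continuous
  constructor
  · intro hyc
    have hcl : IsClosed {y : Plane | e y 1 ≤ γ (e y 0)} := isClosed_le (by fun_prop) (by fun_prop)
    have h1 : y ∈ closure (Metric.ball x r ∩ Ω) :=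
      Metric.isOpen_ball.inter_closure ⟨hy, hyc⟩
    exact closure_minimal (fun z hz => ((h.mem_iff z hz.1).1 hz.2).le) hcl h1
  · intro hle
    have hlim : Tendsto (fun δ : ℝ => y - δ • e.symm (EuclideanSpace.single 1 1)) (𝓝[>] 0) (𝓝 y) := by
      have hc : Continuous fun δ : ℝ => y - δ • e.symm (EuclideanSpace.single (1 : Fin 2) (1 : ℝ)) := by
        fun_prop
      simpa using (hc.tendsto 0).mono_left (nhdsWithin_le_nhds (s := Ioi 0))
    refine mem_closure_of_tendsto hlim ?_
    filter_upwards [hlim (Metric.isOpen_ball.mem_nhds hy), self_mem_nhdsWithin] with δ hδ hδ0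
    have hδ0 : 0 < δ := hδ0
    refine (h.mem_iff _ hδ).2 ?_
    simp only [map_sub, map_smul, LinearIsometryEquiv.apply_symm_apply, PiLp.sub_apply,
      PiLp.smul_apply, PiLp.single_apply]
    simp
    linarith

theorem IsChart.mem_frontier_iff (h : IsChart Ω x e γ K r) (hΩ : IsOpen Ω) {y : Plane}
    (hy : y ∈ Metric.ball x r) : y ∈ frontier Ω ↔ e y 1 = γ (e y 0) := by
  rw [hΩ.frontier_eq, Set.mem_sdiff, h.mem_closure_iff hy, h.mem_iff y hy, not_lt]
  exact ⟨fun h => le_antisymm h.1 h.2, fun h => ⟨h.le, h.ge⟩⟩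

/-- The downward cone of slope `K` with apex `x`, cut by the ball, is open, convex and contained in
`Ω`, with `x` in its closure. Hence derivatives within `closure Ω` are unique. -/
theorem IsChart.uniqueDiffWithinAt (h : IsChart Ω x e γ K r) (hx : x ∈ closure Ω) :
    UniqueDiffWithinAt ℝ (closure Ω) x := by
  have hx1 := (h.mem_closure_iff (Metric.mem_ball_self h.pos)).1 hx
  set g : Plane → ℝ := fun y => e y 1 + K * |e y 0 - e x 0| with hg
  set C : Set Plane := {y | y ∈ Metric.ball x r ∧ g y < e x 1} with hC
  have hgc : Continuous g := by fun_prop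
  have hCo : IsOpen C := Metric.isOpen_ball.inter (isOpen_lt hgc continuous_const)
  have hconv : Convex ℝ C := by
    have hgconv : ConvexOn ℝ (Metric.ball x r) g := by
      refine ⟨convex_ball x r, fun y _ z _ a b ha hb hab => ?_⟩
      simp only [hg, map_add, map_smul, PiLp.add_apply, PiLp.smul_apply, smul_eq_mul]
      have h1 : a * e y 0 + b * e z 0 - e x 0 = a * (e y 0 - e x 0) + b * (e z 0 - e x 0) := by
        linear_combination e x 0 * hab
      rw [h1]
      have h2 := abs_add_le (a * (e y 0 - e x 0)) (b * (e z 0 - e x 0))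
      rw [abs_mul, abs_mul, abs_of_nonneg ha, abs_of_nonneg hb] at h2
      nlinarith [K.coe_nonneg, mul_le_mul_of_nonneg_left h2 K.coe_nonneg]
    exact hgconv.convex_lt (e x 1)
  have hlim : Tendsto (fun δ : ℝ => x - δ • e.symm (EuclideanSpace.single 1 1)) (𝓝[>] 0) (𝓝 x) := by
    have hc : Continuous fun δ : ℝ => x - δ • e.symm (EuclideanSpace.single (1 : Fin 2) (1 : ℝ)) := by
      fun_prop
    simpa using (hc.tendsto 0).mono_left (nhdsWithin_le_nhds (s := Ioi 0))
  have hev : ∀ᶠ δ : ℝ in 𝓝[>] 0, x - δ • e.symm (EuclideanSpace.single 1 1) ∈ C := by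
    filter_upwards [hlim (Metric.isOpen_ball.mem_nhds (Metric.mem_ball_self h.pos)),
      self_mem_nhdsWithin] with δ hδ hδ0
    have hδ0 : 0 < δ := hδ0
    refine ⟨hδ, ?_⟩
    simp only [hg, map_sub, map_smul, LinearIsometryEquiv.apply_symm_apply, PiLp.sub_apply,
      PiLp.smul_apply, PiLp.single_apply]
    simp
    linarith
  have hne : C.Nonempty := by
    obtain ⟨δ, hδ⟩ := hev.exists
    exact ⟨_, hδ⟩
  refine (uniqueDiffWithinAt_convex hconv (by rwa [hCo.interior_eq])
    (mem_closure_of_tendsto hlim hev)).mono fun y hy => subset_closure ?_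
  refine (h.mem_iff y hy.1).2 ?_
  have h1 := h.lipschitz.dist_le_mul (e x 0) (e y 0)
  rw [Real.dist_eq, Real.dist_eq, abs_sub_comm (e x 0)] at h1
  have h2 : e y 1 + K * |e y 0 - e x 0| < e x 1 := hy.2
  linarith [le_abs_self (γ (e x 0) - γ (e y 0))]

/-- The upward unit normal of the graph of `γ` above `s`, in the coordinates given by `e`. -/
noncomputable def graphNormal (e : Plane ≃ₗᵢ[ℝ] Plane) (γ : ℝ → ℝ) (s : ℝ) : Plane :=
  (√(1 + deriv γ s ^ 2))⁻¹ • e.symm !₂[-deriv γ s, 1]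

theorem inner_graphNormal (v : Plane) (s : ℝ) :
    inner ℝ v (graphNormal e γ s) = (√(1 + deriv γ s ^ 2))⁻¹ * (e v 1 - deriv γ s * e v 0) := by
  rw [graphNormal, inner_smul_right, ← e.inner_map_map, e.apply_symm_apply, inner_plane]
  simp
  left
  ring

theorem norm_graphNormal (s : ℝ) : ‖graphNormal e γ s‖ = 1 := by
  have h1 : 0 < 1 + deriv γ s ^ 2 := by positivity
  have h2 : ‖graphNormal e γ s‖ ^ 2 = 1 := by
    rw [← real_inner_self_eq_norm_sq, inner_graphNormal]
    simp only [graphNormal, map_smul, e.apply_symm_apply, PiLp.smul_apply]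
    simp only [smul_eq_mul]
    simp
    have := Real.sq_sqrt h1.le
    have h0 := (Real.sqrt_pos.2 h1).ne'
    field_simp
    linarith
  nlinarith [norm_nonneg (graphNormal e γ s)]

/-- Up to the factor `1/√(1 + γ'²) ≤ 1`, the inner product with the normal is the height above the
tangent line, which differs from the height above the graph by a first-order error. -/
theorem IsChart.isOutwardUnitNormal (h : IsChart Ω x e γ K r) {y : Plane}
    (hy : y ∈ Metric.ball x r) (hyγ : e y 1 = γ (e y 0)) (hd : DifferentiableAt ℝ γ (e y 0)) :
    IsOutwardUnitNormal Ω y (graphNormal e γ (e y 0)) := by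
  refine ⟨norm_graphNormal _, fun ε hε => ?_⟩
  have h1 : ∀ᶠ s in 𝓝 (e y 0), ‖γ s - γ (e y 0) - (s - e y 0) • deriv γ (e y 0)‖ ≤
      ε * ‖s - e y 0‖ := (hasDerivAt_iff_isLittleO.1 hd.hasDerivAt).def hε
  have hc : Continuous fun z : Plane => e z 0 := by fun_prop
  filter_upwards [hc.continuousAt.eventually h1, Metric.isOpen_ball.mem_nhds hy] with z hz hzb
  rw [inner_graphNormal, h.mem_iff z hzb, map_sub, PiLp.sub_apply, PiLp.sub_apply, hyγ]
  have hn : |e z 0 - e y 0| ≤ ‖z - y‖ := by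
    have := abs_apply_le_norm (e (z - y)) 0
    rwa [e.norm_map, map_sub, PiLp.sub_apply] at this
  rw [Real.norm_eq_abs, Real.norm_eq_abs, smul_eq_mul] at hz
  have hz2 := hz.trans (mul_le_mul_of_nonneg_left hn hε.le)
  obtain ⟨hl, hu⟩ := abs_le.1 hz2
  have hw1 : 1 ≤ √(1 + deriv γ (e y 0) ^ 2) :=
    Real.one_le_sqrt.2 (by nlinarith [sq_nonneg (deriv γ (e y 0))])
  have hw0 : 0 < √(1 + deriv γ (e y 0) ^ 2) := by linarith
  have hb : ε * ‖z - y‖ ≤ ε * ‖z - y‖ * √(1 + deriv γ (e y 0) ^ 2) :=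
    le_mul_of_one_le_right (by positivity) hw1
  constructor
  · intro hlt
    rw [inv_mul_lt_iff₀ hw0] at hlt
    nlinarith
  · intro hlt
    rw [lt_inv_mul_iff₀ hw0] at hlt
    rw [not_lt]
    nlinarith

end Chart

theorem IsBoundedLipschitzDomain.uniqueDiffOn {Ω : Set Plane} (hΩ : IsBoundedLipschitzDomain Ω) :
    UniqueDiffOn ℝ (closure Ω) := fun _ hx => by
  obtain ⟨e, γ, K, r, h⟩ := hΩ.exists_chart hx
  exact h.uniqueDiffWithinAt hx

theorem IsBoundedLipschitzDomain.isCompact_closure {Ω : Set Plane}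
    (hΩ : IsBoundedLipschitzDomain Ω) : IsCompact (closure Ω) :=
  hΩ.isBounded.isCompact_closure

theorem IsBoundedLipschitzDomain.closure_mem_nhds {Ω : Set Plane}
    (hΩ : IsBoundedLipschitzDomain Ω) {x : Plane} (hx : x ∈ Ω) : closure Ω ∈ 𝓝 x :=
  mem_of_superset (hΩ.isOpen.mem_nhds hx) subset_closure


/-! ### The divergence theorem for fields supported in a chart -/

/-- The point of the plane with given coordinates with respect to `e`. -/
noncomputable def ofCoords (e : Plane ≃ₗᵢ[ℝ] Plane) : ℝ × ℝ →L[ℝ] Plane :=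
  (e.symm : Plane →L[ℝ] Plane) ∘L
    ((ContinuousLinearMap.fst ℝ ℝ ℝ).smulRight (EuclideanSpace.single (0 : Fin 2) (1 : ℝ)) +
      (ContinuousLinearMap.snd ℝ ℝ ℝ).smulRight (EuclideanSpace.single (1 : Fin 2) (1 : ℝ)))

section Coords

variable (e : Plane ≃ₗᵢ[ℝ] Plane)

theorem apply_ofCoords_zero (p : ℝ × ℝ) : e (ofCoords e p) 0 = p.1 := by
  simp [ofCoords]

theorem apply_ofCoords_one (p : ℝ × ℝ) : e (ofCoords e p) 1 = p.2 := by
  simp [ofCoords]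

theorem ofCoords_coords (y : Plane) : ofCoords e (e y 0, e y 1) = y := by
  apply e.injective
  ext i
  fin_cases i
  · exact apply_ofCoords_zero e _
  · exact apply_ofCoords_one e _

theorem ofCoords_one_zero : ofCoords e (1, 0) = e.symm (EuclideanSpace.single 0 1) := by
  simp [ofCoords]

theorem ofCoords_zero_one : ofCoords e (0, 1) = e.symm (EuclideanSpace.single 1 1) := by
  simp [ofCoords]

theorem ofCoords_eq_measurableEquiv : ⇑(ofCoords e) =
    ⇑((MeasurableEquiv.finTwoArrow (α := ℝ)).symm.trans ((MeasurableEquiv.toLp 2 (Fin 2 → ℝ)).trans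
      e.symm.toMeasurableEquiv)) := by
  funext p
  apply e.injective
  ext i
  have : ∀ q : Fin 2 → ℝ, e (e.symm.toMeasurableEquiv (MeasurableEquiv.toLp 2 (Fin 2 → ℝ) q)) i = q i := by
    intro q
    simp [MeasurableEquiv.toLp_apply]
  simp only [MeasurableEquiv.trans_apply]
  rw [this]
  fin_cases i
  · exact apply_ofCoords_zero e _
  · exact apply_ofCoords_one e _

theorem measurableEmbedding_ofCoords : MeasurableEmbedding (ofCoords e) := by
  rw [ofCoords_eq_measurableEquiv]; exact MeasurableEquiv.measurableEmbedding _

theorem measurePreserving_ofCoords : MeasurePreserving (ofCoords e) := by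
  rw [ofCoords_eq_measurableEquiv]
  exact e.symm.measurePreserving.comp ((PiLp.volume_preserving_toLp (Fin 2)).comp
    (volume_preserving_finTwoArrow ℝ).symm)

/-- The trace is the same in every orthonormal basis, so the divergence may be computed in the
coordinates of a chart. -/
theorem sum_diag_eq (L : Plane →L[ℝ] Plane) :
    ∑ j, L (EuclideanSpace.single j 1) j =
      e (L (ofCoords e (1, 0))) 0 + e (L (ofCoords e (0, 1))) 1 := by
  have h1 := LinearMap.trace_eq_sum_inner (L : Plane →ₗ[ℝ] Plane) (EuclideanSpace.basisFun (Fin 2) ℝ)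
  have h2 := LinearMap.trace_eq_sum_inner (L : Plane →ₗ[ℝ] Plane)
    ((EuclideanSpace.basisFun (Fin 2) ℝ).map e.symm)
  rw [h1] at h2
  simp only [OrthonormalBasis.map_apply, Fin.sum_univ_two] at h2
  simp only [← e.inner_map_map (e.symm _), e.apply_symm_apply] at h2
  simp only [inner_plane, EuclideanSpace.basisFun_apply, PiLp.single_apply] at h2
  rw [ofCoords_one_zero, ofCoords_zero_one, Fin.sum_univ_two]
  simpa using h2

theorem dist_ofCoords_sq (p q : ℝ × ℝ) :
    dist (ofCoords e p) (ofCoords e q) ^ 2 = (p.1 - q.1) ^ 2 + (p.2 - q.2) ^ 2 := by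
  rw [← e.dist_map, EuclideanSpace.dist_eq, Real.sq_sqrt (by positivity), Fin.sum_univ_two,
    apply_ofCoords_zero, apply_ofCoords_zero, apply_ofCoords_one, apply_ofCoords_one,
    Real.dist_eq, Real.dist_eq, sq_abs, sq_abs]

end Coords

/-- The divergence of a vector field on `closure Ω`. -/
noncomputable def divergence (Ω : Set Plane) (G : Plane → Plane) (x : Plane) : ℝ :=
  ∑ j, pderiv Ω j (fun y => G y j) x

theorem pderiv_eq_fderiv {Ω : Set Plane} (hΩ : IsBoundedLipschitzDomain Ω) {x : Plane} (hx : x ∈ Ω)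
    (i : Fin 2) (f : Plane → ℝ) : pderiv Ω i f x = fderiv ℝ f x (EuclideanSpace.single i 1) := by
  rw [pderiv, fderivWithin_of_mem_nhds (hΩ.closure_mem_nhds hx)]

theorem divergence_eq_sum_fderiv {Ω : Set Plane} (hΩ : IsBoundedLipschitzDomain Ω)
    {G : Plane → Plane} {x : Plane} (hx : x ∈ Ω) (hG : DifferentiableAt ℝ G x) :
    divergence Ω G x = ∑ j, fderiv ℝ G x (EuclideanSpace.single j 1) j := by
  refine Finset.sum_congr rfl fun j _ => ?_
  rw [pderiv_eq_fderiv hΩ hx]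
  have := ((EuclideanSpace.proj j : Plane →L[ℝ] ℝ).hasFDerivAt (x := G x)).comp x hG.hasFDerivAt
  have h2 : HasFDerivAt (fun y => G y j) ((EuclideanSpace.proj j : Plane →L[ℝ] ℝ) ∘L fderiv ℝ G x) x :=
    this
  rw [h2.fderiv]; rfl

theorem exists_norm_fderiv_le {Ω : Set Plane} (hΩ : IsBoundedLipschitzDomain Ω)
    {G : Plane → Plane} (hG : ContDiffOn ℝ 1 G (closure Ω)) :
    ∃ M, 0 ≤ M ∧ ∀ x ∈ Ω, ‖fderiv ℝ G x‖ ≤ M := by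
  obtain ⟨M, hM⟩ := hΩ.isCompact_closure.exists_bound_of_continuousOn
    (hG.continuousOn_fderivWithin hΩ.uniqueDiffOn le_rfl)
  refine ⟨max M 0, le_max_right _ _, fun x hx => ?_⟩
  rw [← fderivWithin_of_mem_nhds (hΩ.closure_mem_nhds hx)]
  exact (hM x (subset_closure hx)).trans (le_max_left _ _)

section LocalDivergence

variable {Ω : Set Plane} {x : Plane} {e : Plane ≃ₗᵢ[ℝ] Plane} {γ : ℝ → ℝ} {K : ℝ≥0} {r : ℝ}
  {G : Plane → Plane} {S : Set Plane}

/-- The region below the whole graph extends past the ball, where it is unrelated to `Ω`. There `G`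
vanishes near each point, since its support lies in the closed set `S` inside the ball. -/
theorem IsChart.contDiffAt (h : IsChart Ω x e γ K r) (hΩ : IsBoundedLipschitzDomain Ω)
    (hG : ContDiffOn ℝ 1 G (closure Ω)) (hS : IsClosed S) (hSr : S ⊆ Metric.ball x r)
    (hG0 : ∀ y ∉ S, G y = 0) {y : Plane} (hy : e y 1 < γ (e y 0)) : ContDiffAt ℝ 1 G y := by
  by_cases hyb : y ∈ Metric.ball x r
  · exact hG.contDiffAt (hΩ.closure_mem_nhds ((h.mem_iff y hyb).2 hy))
  · have : G =ᶠ[𝓝 y] fun _ => 0 := by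
      filter_upwards [hS.isOpen_compl.mem_nhds (fun hyS => hyb (hSr hyS))] with z hz using hG0 z hz
    exact contDiffAt_const.congr_of_eventuallyEq this

theorem IsChart.continuousOn (h : IsChart Ω x e γ K r)
    (hG : ContDiffOn ℝ 1 G (closure Ω)) (hS : IsClosed S) (hSr : S ⊆ Metric.ball x r)
    (hG0 : ∀ y ∉ S, G y = 0) : ContinuousOn G {y | e y 1 ≤ γ (e y 0)} := by
  intro y hy
  by_cases hyb : y ∈ Metric.ball x r
  · have h1 := hG.continuousOn y ((h.mem_closure_iff hyb).2 hy)
    refine h1.mono_of_mem_nhdsWithin ?_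
    filter_upwards [self_mem_nhdsWithin, mem_nhdsWithin_of_mem_nhds
      (Metric.isOpen_ball.mem_nhds hyb)] with z hz hzb using (h.mem_closure_iff hzb).2 hz
  · have : G =ᶠ[𝓝 y] fun _ => 0 := by
      filter_upwards [hS.isOpen_compl.mem_nhds (fun hyS => hyb (hSr hyS))] with z hz using hG0 z hz
    exact (continuousAt_const.congr this.symm).continuousWithinAt

theorem fderiv_eq_zero_of_forall_notMem (hS : IsClosed S) (hG0 : ∀ y ∉ S, G y = 0) {y : Plane}
    (hy : y ∉ S) : fderiv ℝ G y = 0 := by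
  have : G =ᶠ[𝓝 y] fun _ => 0 := by
    filter_upwards [hS.isOpen_compl.mem_nhds hy] with z hz using hG0 z hz
  rw [this.fderiv_eq, fderiv_fun_const]; rfl

theorem IsChart.integral_divergence_eq (h : IsChart Ω x e γ K r) (hΩ : IsBoundedLipschitzDomain Ω)
    (hG : ContDiffOn ℝ 1 G (closure Ω)) (hS : IsCompact S) (hSr : S ⊆ Metric.ball x r)
    (hG0 : ∀ y ∉ S, G y = 0) :
    ∫ y in Ω, divergence Ω G y = (∫ s, e (G (ofCoords e (s, γ s))) 1) -
      ∫ s, deriv γ s * e (G (ofCoords e (s, γ s))) 0 := by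
  have hγ := h.lipschitz.continuous
  set U : Set (ℝ × ℝ) := {p | p.2 < γ p.1} with hU
  have hUm : MeasurableSet U := (isOpen_subgraph hγ).measurableSet
  have hlow : ∀ p : ℝ × ℝ, p ∈ U → e (ofCoords e p) 1 < γ (e (ofCoords e p) 0) := by
    intro p hp
    rw [apply_ofCoords_zero, apply_ofCoords_one]; exact hp
  obtain ⟨M, hM0, hM⟩ := exists_norm_fderiv_le hΩ hG
  have hM' : ∀ p ∈ U, ‖fderiv ℝ G (ofCoords e p)‖ ≤ M := by
    intro p hp
    by_cases hyS : ofCoords e p ∈ S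
    · exact hM _ ((h.mem_iff _ (hSr hyS)).2 (hlow p hp))
    · rw [fderiv_eq_zero_of_forall_notMem hS.isClosed hG0 hyS, norm_zero]; exact hM0
  obtain ⟨R, hR⟩ : ∃ R, ∀ p : ℝ × ℝ, R ≤ ‖p‖ → ofCoords e p ∉ S := by
    have hc : ContinuousOn (fun y : Plane => ((e y 0, e y 1) : ℝ × ℝ)) S := by fun_prop
    obtain ⟨R, hR⟩ := hS.exists_bound_of_continuousOn hc
    refine ⟨R + 1, fun p hp hpS => ?_⟩
    have := hR _ hpS
    rw [apply_ofCoords_zero, apply_ofCoords_one] at this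
    change ‖p‖ ≤ R at this
    linarith
  let f : Fin 2 → ℝ × ℝ → ℝ := fun i p => e (G (ofCoords e p)) i
  let f' : Fin 2 → ℝ × ℝ → ℝ × ℝ →L[ℝ] ℝ := fun i p =>
    ((EuclideanSpace.proj i : Plane →L[ℝ] ℝ) ∘L (e : Plane →L[ℝ] Plane)) ∘L
      (fderiv ℝ G (ofCoords e p) ∘L ofCoords e)
  have hcont : ∀ i, ContinuousOn (f i) {p | p.2 ≤ γ p.1} := by
    intro i
    have h1 := (h.continuousOn hG hS.isClosed hSr hG0).comp (ofCoords e).continuous.continuousOn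
      (s := {p : ℝ × ℝ | p.2 ≤ γ p.1}) (fun p hp => by
        simp only [mem_ofPred_eq, apply_ofCoords_zero, apply_ofCoords_one]; exact hp)
    have h2 : Continuous fun v : Plane => e v i := by fun_prop
    exact h2.comp_continuousOn h1
  have hd : ∀ i, ∀ p : ℝ × ℝ, p.2 < γ p.1 → HasFDerivAt (f i) (f' i p) p := by
    intro i p hp
    have h1 := ((h.contDiffAt hΩ hG hS.isClosed hSr hG0 (hlow p hp)).differentiableAt
      one_ne_zero).hasFDerivAt.comp p (ofCoords e).hasFDerivAt
    exact ((EuclideanSpace.proj i : Plane →L[ℝ] ℝ) ∘L (e : Plane →L[ℝ] Plane)).hasFDerivAt.comp p h1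
  have hc' : ∀ i, ContinuousOn (f' i) U := by
    intro i
    have h1 : ContinuousOn (fun p => fderiv ℝ G (ofCoords e p)) U := by
      intro p hp
      have h2 := ((h.contDiffAt hΩ hG hS.isClosed hSr hG0 (hlow p hp)).fderiv_right
        (m := 0) (by norm_num)).continuousAt
      exact (ContinuousAt.comp (f := ofCoords e) h2 (ofCoords e).continuous.continuousAt).continuousWithinAt
    exact continuousOn_const.clm_comp (h1.clm_comp continuousOn_const)
  have hMf : ∀ i, ∀ p : ℝ × ℝ, p.2 < γ p.1 → ‖f' i p‖ ≤
      ‖(EuclideanSpace.proj i : Plane →L[ℝ] ℝ) ∘L (e : Plane →L[ℝ] Plane)‖ * (M * ‖ofCoords e‖) := by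
    intro i p hp
    refine (ContinuousLinearMap.opNorm_comp_le _ _).trans ?_
    gcongr
    refine (ContinuousLinearMap.opNorm_comp_le _ _).trans ?_
    gcongr
    exact hM' p hp
  have hRf : ∀ i, ∀ p, R ≤ ‖p‖ → f i p = 0 ∧ f' i p = 0 := by
    intro i p hp
    have hnS := hR p hp
    simp only [f, f', hG0 _ hnS, fderiv_eq_zero_of_forall_notMem hS.isClosed hG0 hnS]
    simp
  have hi0 := integrableOn_subgraph hγ (hc' 0) (hMf 0) (hRf 0) (w := fun _ => 1) measurable_const
    (C := 1) (by simp) (1, 0)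
  have hi1 := integrableOn_subgraph hγ (hc' 1) (hMf 1) (hRf 1) (w := fun _ => 1) measurable_const
    (C := 1) (by simp) (0, 1)
  have hv1 := integral_subgraph_vertical hγ (hcont 1) (hd 1) (hc' 1) (hMf 1) (hRf 1)
    (w := fun _ => 1) measurable_const (C := 1) (by simp)
  have hv0 := integral_subgraph_horizontal h.lipschitz (hcont 0) (hd 0) (hc' 0) (hMf 0) (hRf 0)
  simp only [one_mul] at hi0 hi1 hv1
  set D : Plane → ℝ := fun y => ∑ j, fderiv ℝ G y (EuclideanSpace.single j 1) j with hD
  have hDe : ∀ p, D (ofCoords e p) = f' 0 p (1, 0) + f' 1 p (0, 1) := fun p =>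
    sum_diag_eq e (fderiv ℝ G (ofCoords e p))
  calc ∫ y in Ω, divergence Ω G y = ∫ y in Ω, D y := by
        refine setIntegral_congr_fun hΩ.isOpen.measurableSet fun y hy => ?_
        exact divergence_eq_sum_fderiv hΩ hy
          ((hG.contDiffAt (hΩ.closure_mem_nhds hy)).differentiableAt one_ne_zero)
    _ = ∫ y, indicator Ω D y := (integral_indicator hΩ.isOpen.measurableSet).symm
    _ = ∫ p, indicator Ω D (ofCoords e p) :=
        ((measurePreserving_ofCoords e).integral_comp (measurableEmbedding_ofCoords e) _).symm
    _ = ∫ p, indicator U (fun p => f' 0 p (1, 0) + f' 1 p (0, 1)) p := by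
        congr 1; ext p
        -- On `S` the chart identifies `Ω` with `U`; off `S` both integrands vanish.
        by_cases hpS : ofCoords e p ∈ S
        · have hiff := h.mem_iff _ (hSr hpS)
          rw [apply_ofCoords_zero, apply_ofCoords_one] at hiff
          by_cases hp : p ∈ U
          · rw [indicator_of_mem hp, indicator_of_mem (hiff.2 hp), hDe]
          · rw [indicator_of_notMem hp, indicator_of_notMem (fun h' => hp (hiff.1 h'))]
        · have h0 : D (ofCoords e p) = 0 := by
            simp [hD, fderiv_eq_zero_of_forall_notMem hS.isClosed hG0 hpS]
          have h0' := hDe p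
          rw [h0] at h0'
          have h1 : indicator U (fun p => f' 0 p (1, 0) + f' 1 p (0, 1)) p = 0 :=
            indicator_apply_eq_zero.2 fun _ => h0'.symm
          rw [h1]
          exact indicator_apply_eq_zero.2 fun _ => h0
    _ = ∫ p in U, (f' 0 p (1, 0) + f' 1 p (0, 1)) := integral_indicator hUm
    _ = _ := by
        rw [integral_add hi0 hi1, hv0, hv1]
        ring

/-- In the graph coordinate the length density `√(1 + γ'²)` cancels the normalisation of
`graphNormal`, leaving the expression of `integral_divergence_eq`. -/
theorem IsChart.lineIntegral_eq (h : IsChart Ω x e γ K r) (hΩ : IsBoundedLipschitzDomain Ω)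
    (hG : ContDiffOn ℝ 1 G (closure Ω)) (hS : IsCompact S) (hSr : S ⊆ Metric.ball x r)
    (hG0 : ∀ y ∉ S, G y = 0) :
    IntegrableOn (fun y => inner ℝ (G y) (outwardNormal Ω y)) (frontier Ω)
      (Measure.hausdorffMeasure 1) ∧
    lineIntegral (frontier Ω) (fun y => inner ℝ (G y) (outwardNormal Ω y)) =
      (∫ s, e (G (ofCoords e (s, γ s))) 1) - ∫ s, deriv γ s * e (G (ofCoords e (s, γ s))) 0 := by
  have hγ := h.lipschitz.continuous
  set q : Plane → ℝ := fun y => inner ℝ (G y) (outwardNormal Ω y) with hq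
  have hq0 : ∀ y ∉ S, q y = 0 := fun y hy => by simp [hq, hG0 y hy]
  set P : ℝ → Plane := fun s => ofCoords e (s, γ s) with hPdef
  have hP : ∀ s s', dist (P s) (P s') ^ 2 = (s - s') ^ 2 + (γ s - γ s') ^ 2 := fun s s' =>
    dist_ofCoords_sq e _ _
  have hemb := (graph_isClosedEmbedding h.lipschitz hP)
  have hmem : ∀ y, y ∈ range P ↔ e y 1 = γ (e y 0) := by
    intro y
    constructor
    · rintro ⟨s, rfl⟩
      rw [hPdef, apply_ofCoords_zero, apply_ofCoords_one]
    · intro hy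
      refine ⟨e y 0, ?_⟩
      rw [hPdef]; dsimp only
      rw [← hy, ofCoords_coords]
  have hind : indicator (frontier Ω) q = indicator (range P) q := by
    ext y
    by_cases hyS : y ∈ S
    · have hiff : y ∈ frontier Ω ↔ y ∈ range P := by
        rw [hmem, h.mem_frontier_iff hΩ.isOpen (hSr hyS)]
      by_cases hy : y ∈ range P
      · rw [indicator_of_mem hy, indicator_of_mem (hiff.2 hy)]
      · rw [indicator_of_notMem hy, indicator_of_notMem fun h' => hy (hiff.1 h')]
    · exact (indicator_apply_eq_zero.2 fun _ => hq0 y hyS).trans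
        (indicator_apply_eq_zero.2 fun _ => hq0 y hyS).symm
  have hcontP : Continuous fun s => G (P s) := by
    have h1 := (h.continuousOn hG hS.isClosed hSr hG0).comp hemb.continuous.continuousOn
      (s := univ) (fun s _ => ((hmem (P s)).1 ⟨s, rfl⟩).le)
    exact continuousOn_univ.1 h1
  have hsupp : HasCompactSupport fun s => G (P s) := by
    refine HasCompactSupport.of_support_subset_isCompact (hemb.isCompact_preimage hS) fun s hs => ?_
    by_contra hs'
    exact hs (hG0 _ hs')
  have hint : ∀ i, Integrable fun s => e (G (P s)) i := by
    intro i
    have hc : Continuous fun v : Plane => e v i := by fun_prop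
    refine (hc.comp hcontP).integrable_of_hasCompactSupport ?_
    exact hsupp.comp_left (g := fun v : Plane => e v i) (by simp)
  have hint' : Integrable fun s => deriv γ s * e (G (P s)) 0 :=
    (hint 0).bdd_mul (measurable_deriv γ).aestronglyMeasurable
      (Eventually.of_forall fun s => norm_deriv_le_of_lipschitz h.lipschitz)
  set w : ℝ → ℝ≥0∞ := fun s => ENNReal.ofReal √(1 + deriv γ s ^ 2) with hw
  have hwm : Measurable w := by
    have := measurable_deriv γ
    fun_prop
  have hwt : ∀ᵐ s : ℝ, w s < ∞ := Eventually.of_forall fun s => ENNReal.ofReal_lt_top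
  have hae : ∀ᵐ s : ℝ, (w s).toReal • q (P s) =
      e (G (P s)) 1 - deriv γ s * e (G (P s)) 0 := by
    filter_upwards [h.lipschitz.ae_differentiableAt] with s hs
    by_cases hsS : P s ∈ S
    · have h0 : e (P s) 0 = s := apply_ofCoords_zero e _
      have hn := h.isOutwardUnitNormal (hSr hsS) ((hmem _).1 ⟨s, rfl⟩) (by rwa [h0])
      rw [h0] at hn
      simp only [hq]
      have hpos : 0 < √(1 + deriv γ s ^ 2) := Real.sqrt_pos.2 (by positivity)
      rw [outwardNormal_eq hn, inner_graphNormal, hw, ENNReal.toReal_ofReal hpos.le, smul_eq_mul,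
        ← mul_assoc, mul_inv_cancel₀ hpos.ne', one_mul]
    · rw [hq0 _ hsS, hG0 _ hsS]; simp
  have hrest := hausdorffMeasure_restrict_graph h.lipschitz hP
  have hfm : MeasurableSet (frontier Ω) := isClosed_frontier.measurableSet
  have hrm : MeasurableSet (range P) := hemb.isClosed_range.measurableSet
  constructor
  · rw [← integrable_indicator_iff hfm, hind, integrable_indicator_iff hrm, IntegrableOn, hrest,
      hemb.measurableEmbedding.integrable_map_iff,
      integrable_withDensity_iff_integrable_smul' hwm hwt]
    exact ((hint 1).sub hint').congr (hae.mono fun s hs => hs.symm)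
  · rw [lineIntegral, ← integral_indicator hfm, hind, integral_indicator hrm, hrest,
      hemb.measurableEmbedding.integral_map, integral_withDensity_eq_integral_toReal_smul hwm hwt,
      integral_congr_ae hae, integral_sub (hint 1) hint']

end LocalDivergence

/-! ### The divergence theorem -/

open scoped Manifold ContDiff in
/-- The divergence theorem on a bounded Lipschitz domain, for a vector field of class `C¹` up to
the boundary. -/
theorem IsBoundedLipschitzDomain.divergence_theorem {Ω : Set Plane}
    (hΩ : IsBoundedLipschitzDomain Ω) {G : Plane → Plane} (hG : ContDiffOn ℝ 1 G (closure Ω)) :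
    IntegrableOn (fun y => inner ℝ (G y) (outwardNormal Ω y)) (frontier Ω)
      (Measure.hausdorffMeasure 1) ∧
    ∫ y in Ω, divergence Ω G y =
      lineIntegral (frontier Ω) (fun y => inner ℝ (G y) (outwardNormal Ω y)) := by
  choose! e γ K r hch using fun x (hx : x ∈ closure Ω) => hΩ.exists_chart hx
  obtain ⟨t, ht, hcov⟩ := hΩ.isCompact_closure.elim_nhds_subcover (fun x => Metric.ball x (r x))
    (fun x hx => Metric.ball_mem_nhds x (hch x hx).pos)
  obtain ⟨χ, hχ⟩ := SmoothPartitionOfUnity.exists_isSubordinate 𝓘(ℝ, Plane) isClosed_closure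
    (fun i : t => Metric.ball (i : Plane) (r i)) (fun i => Metric.isOpen_ball) (by
      intro y hy
      obtain ⟨x, hx, hyx⟩ := mem_iUnion₂.1 (hcov hy)
      exact mem_iUnion.2 ⟨⟨x, hx⟩, hyx⟩)
  have hsum : ∀ y ∈ closure Ω, ∑ i, χ i y = 1 := fun y hy => by
    rw [← finsum_eq_sum_of_fintype]; exact χ.sum_eq_one hy
  have hχs : ∀ i, ContDiff ℝ 1 (χ i) := fun i =>
    ((χ i).contMDiff.contDiff).of_le (by exact_mod_cast le_top)
  have hGi : ∀ i, ContDiffOn ℝ 1 (fun y => χ i y • G y) (closure Ω) := fun i =>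
    (hχs i).contDiffOn.smul hG
  have hcompact : ∀ i, IsCompact (tsupport (χ i)) := fun i =>
    Metric.isCompact_of_isClosed_isBounded (isClosed_tsupport _)
      (Metric.isBounded_ball.subset (hχ i))
  have hzero : ∀ i, ∀ y ∉ tsupport (χ i), χ i y • G y = 0 := fun i y hy => by
    rw [image_eq_zero_of_notMem_tsupport hy, zero_smul]
  have hline := fun i : t => (hch i (ht i i.2)).lineIntegral_eq hΩ (hGi i) (hcompact i) (hχ i) (hzero i)
  have hdiv := fun i : t =>
    (hch i (ht i i.2)).integral_divergence_eq hΩ (hGi i) (hcompact i) (hχ i) (hzero i)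
  have hbd : ∀ y ∈ frontier Ω, inner ℝ (G y) (outwardNormal Ω y) =
      ∑ i, inner ℝ (χ i y • G y) (outwardNormal Ω y) := fun y hy => by
    rw [← sum_inner, ← Finset.sum_smul, hsum y (frontier_subset_closure hy), one_smul]
  have hin : ∀ y ∈ Ω, divergence Ω G y = ∑ i, divergence Ω (fun y => χ i y • G y) y := fun y hy => by
    have hdiff : ∀ H : Plane → Plane, ContDiffOn ℝ 1 H (closure Ω) → DifferentiableAt ℝ H y :=
      fun H hH => (hH.contDiffAt (hΩ.closure_mem_nhds hy)).differentiableAt one_ne_zero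
    -- The weights sum to `1` only on `closure Ω`, but this is a neighbourhood of every point of
    -- `Ω`, so derivatives agree.
    have heq : G =ᶠ[𝓝 y] fun y => ∑ i, χ i y • G y := by
      filter_upwards [hΩ.closure_mem_nhds hy] with z hz
      rw [← Finset.sum_smul, hsum z hz, one_smul]
    rw [divergence_eq_sum_fderiv hΩ hy (hdiff G hG), heq.fderiv_eq,
      fderiv_fun_sum fun i _ => hdiff _ (hGi i)]
    simp only [divergence_eq_sum_fderiv hΩ hy (hdiff _ (hGi _))]
    rw [Finset.sum_comm]
    refine Finset.sum_congr rfl fun j _ => ?_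
    simp
  have hfm : MeasurableSet (frontier Ω) := isClosed_frontier.measurableSet
  have hintd : ∀ i, IntegrableOn (divergence Ω fun y => χ i y • G y) Ω := fun i => by
    have hc : ContinuousOn (divergence Ω fun y => χ i y • G y) (closure Ω) := by
      refine continuousOn_finsetSum _ fun j _ => ?_
      have hj : ContDiffOn ℝ 1 (fun y => (χ i y • G y) j) (closure Ω) :=
        (EuclideanSpace.proj j : Plane →L[ℝ] ℝ).contDiff.comp_contDiffOn (hGi i)
      exact (hj.continuousOn_fderivWithin hΩ.uniqueDiffOn le_rfl).clm_apply continuousOn_const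
    exact (hc.integrableOn_compact hΩ.isCompact_closure).mono_set subset_closure
  refine ⟨?_, ?_⟩
  · refine IntegrableOn.congr_fun ?_ (fun y hy => (hbd y hy).symm) hfm
    exact integrable_finsetSum _ fun i _ => (hline i).1
  · rw [setIntegral_congr_fun hΩ.isOpen.measurableSet hin, integral_finsetSum _ fun i _ => hintd i,
      lineIntegral, setIntegral_congr_fun hfm hbd, integral_finsetSum _ fun i _ => (hline i).1]
    exact Finset.sum_congr rfl fun i _ => (hdiv i).trans (hline i).2.symm


/-! ### Functions of space and time -/

section SpaceTime

variable {Ω : Set Plane} {T : ℝ}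

theorem uniqueDiffOn_spaceTime (hΩ : IsBoundedLipschitzDomain Ω) (hT : 0 < T) :
    UniqueDiffOn ℝ (closure Ω ×ˢ Icc 0 T) :=
  hΩ.uniqueDiffOn.prod (uniqueDiffOn_Icc hT)

theorem contDiffOn_slice {F : Type*} [NormedAddCommGroup F] [NormedSpace ℝ F] {n : WithTop ℕ∞}
    {f : Plane × ℝ → F} (hf : ContDiffOn ℝ n f (closure Ω ×ˢ Icc 0 T)) {t : ℝ} (ht : t ∈ Icc 0 T) :
    ContDiffOn ℝ n (fun y => f (y, t)) (closure Ω) :=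
  hf.comp (f := fun y : Plane => (y, t)) (contDiff_id.prodMk contDiff_const).contDiffOn
    fun _ hy => ⟨hy, ht⟩

theorem continuousOn_time {X : Type*} [TopologicalSpace X] {f : Plane × ℝ → X}
    (hf : ContinuousOn f (closure Ω ×ˢ Icc 0 T)) {x : Plane} (hx : x ∈ closure Ω) :
    ContinuousOn (fun t => f (x, t)) (Icc 0 T) :=
  hf.comp (f := fun t : ℝ => (x, t)) (by fun_prop) fun _ ht => ⟨hx, ht⟩

theorem hasDerivWithinAt_time (hT : 0 < T) {f : Plane × ℝ → ℝ}
    (hf : ContDiffOn ℝ 1 f (closure Ω ×ˢ Icc 0 T)) {x : Plane} (hx : x ∈ closure Ω) {t : ℝ}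
    (ht : t ∈ Icc 0 T) :
    HasDerivWithinAt (fun s => f (x, s)) (derivWithin (fun s => f (x, s)) (Icc 0 T) t)
      (Icc 0 T) t ∧
    derivWithin (fun s => f (x, s)) (Icc 0 T) t =
      fderivWithin ℝ f (closure Ω ×ˢ Icc 0 T) (x, t) (0, 1) := by
  have h1 := (hf.differentiableOn one_ne_zero (x, t) ⟨hx, ht⟩).hasFDerivWithinAt
  have h2 := h1.comp_hasDerivWithinAt (f := fun s : ℝ => (x, s)) (s := Icc 0 T) t
    ((hasDerivAt_const t x).prodMk (hasDerivAt_id t)).hasDerivWithinAt (fun s hs => ⟨hx, hs⟩)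
  have h3 := h2.derivWithin (uniqueDiffOn_Icc hT t ht)
  refine ⟨?_, h3⟩
  have : derivWithin (fun s => f (x, s)) (Icc 0 T) t = _ := h3
  rw [this]; exact h2

/-- Expressing slice derivatives through the space-time derivative makes them regular jointly in
space and time. -/
theorem pderiv_slice (hΩ : IsBoundedLipschitzDomain Ω) {f : Plane × ℝ → ℝ}
    (hf : ContDiffOn ℝ 1 f (closure Ω ×ˢ Icc 0 T)) {x : Plane} (hx : x ∈ closure Ω) {t : ℝ}
    (ht : t ∈ Icc 0 T) (j : Fin 2) :
    pderiv Ω j (fun y => f (y, t)) x =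
      fderivWithin ℝ f (closure Ω ×ˢ Icc 0 T) (x, t) (EuclideanSpace.single j 1, 0) := by
  have h1 := (hf.differentiableOn one_ne_zero (x, t) ⟨hx, ht⟩).hasFDerivWithinAt
  have h2 := h1.comp (f := fun y : Plane => (y, t)) (s := closure Ω) x
    ((hasFDerivAt_id x).prodMk (hasFDerivAt_const t x)).hasFDerivWithinAt (fun y hy => ⟨hy, ht⟩)
  have h3 : fderivWithin ℝ (fun y => f (y, t)) (closure Ω) x = _ :=
    h2.fderivWithin (hΩ.uniqueDiffOn x hx)
  rw [pderiv, h3]; rfl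

theorem contDiffOn_pderiv (hΩ : IsBoundedLipschitzDomain Ω) (hT : 0 < T) {f : Plane × ℝ → ℝ}
    (hf : ContDiffOn ℝ 2 f (closure Ω ×ˢ Icc 0 T)) (j : Fin 2) :
    ContDiffOn ℝ 1 (fun p => pderiv Ω j (fun y => f (y, p.2)) p.1) (closure Ω ×ˢ Icc 0 T) := by
  have h1 : ContDiffOn ℝ 1 (fderivWithin ℝ f (closure Ω ×ˢ Icc 0 T)) (closure Ω ×ˢ Icc 0 T) :=
    hf.fderivWithin (uniqueDiffOn_spaceTime hΩ hT) (by norm_num)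
  exact (h1.clm_apply contDiffOn_const).congr fun p hp =>
    pderiv_slice hΩ (hf.of_le (by norm_num)) hp.1 hp.2 j

theorem continuousOn_pderiv (hΩ : IsBoundedLipschitzDomain Ω) (hT : 0 < T) {f : Plane × ℝ → ℝ}
    (hf : ContDiffOn ℝ 1 f (closure Ω ×ˢ Icc 0 T)) (j : Fin 2) :
    ContinuousOn (fun p => pderiv Ω j (fun y => f (y, p.2)) p.1) (closure Ω ×ˢ Icc 0 T) := by
  have h1 := hf.continuousOn_fderivWithin (uniqueDiffOn_spaceTime hΩ hT) le_rfl
  exact (h1.clm_apply continuousOn_const).congr fun p hp => pderiv_slice hΩ hf hp.1 hp.2 j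

theorem continuousOn_derivWithin_time (hΩ : IsBoundedLipschitzDomain Ω) (hT : 0 < T)
    {f : Plane × ℝ → ℝ} (hf : ContDiffOn ℝ 1 f (closure Ω ×ˢ Icc 0 T)) :
    ContinuousOn (fun p : Plane × ℝ => derivWithin (fun s => f (p.1, s)) (Icc 0 T) p.2)
      (closure Ω ×ˢ Icc 0 T) := by
  have h1 := hf.continuousOn_fderivWithin (uniqueDiffOn_spaceTime hΩ hT) le_rfl
  exact (h1.clm_apply continuousOn_const).congr fun p hp =>
    (hasDerivWithinAt_time hT hf hp.1 hp.2).2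

theorem integrableOn_of_continuousOn_closure (hΩ : IsBoundedLipschitzDomain Ω) {f : Plane → ℝ}
    (hf : ContinuousOn f (closure Ω)) : IntegrableOn f Ω :=
  (hf.integrableOn_compact hΩ.isCompact_closure).mono_set subset_closure

/-- Differentiation of an integral over `Ω` with respect to time, one-sidedly at the end points of
the time interval. -/
theorem hasDerivWithinAt_integral (hΩ : IsBoundedLipschitzDomain Ω) (hT : 0 < T)
    {f : Plane × ℝ → ℝ} (hf : ContDiffOn ℝ 1 f (closure Ω ×ˢ Icc 0 T)) {t : ℝ}
    (ht : t ∈ Icc 0 T) :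
    HasDerivWithinAt (fun s => ∫ x in Ω, f (x, s))
      (∫ x in Ω, derivWithin (fun s => f (x, s)) (Icc 0 T) t) (Icc 0 T) t := by
  obtain ⟨M, hM⟩ := (hΩ.isCompact_closure.prod isCompact_Icc).exists_bound_of_continuousOn
    (continuousOn_derivWithin_time hΩ hT hf)
  have hΩm := hΩ.isOpen.measurableSet
  have hslice : ∀ s ∈ Icc 0 T, ContinuousOn (fun x => f (x, s)) (closure Ω) := fun s hs =>
    (contDiffOn_slice hf hs).continuousOn
  rw [hasDerivWithinAt_iff_tendsto_slope]
  have hmem : ∀ᶠ s in 𝓝[Icc 0 T \ {t}] t, s ∈ Icc 0 T :=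
    (eventually_mem_nhdsWithin).mono fun s hs => hs.1
  have hlim := tendsto_integral_filter_of_dominated_convergence (μ := volume.restrict Ω)
    (l := 𝓝[Icc 0 T \ {t}] t) (F := fun s x => slope (fun s => f (x, s)) t s)
    (f := fun x => derivWithin (fun s => f (x, s)) (Icc 0 T) t) (fun _ => M) ?_ ?_ ?_ ?_
  · refine hlim.congr' ?_
    filter_upwards [hmem] with s hs
    simp only [slope_def_module]
    rw [integral_smul, integral_sub (integrableOn_of_continuousOn_closure hΩ (hslice s hs))
      (integrableOn_of_continuousOn_closure hΩ (hslice t ht))]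
  · filter_upwards [hmem] with s hs
    simp only [slope_def_module]
    exact (integrableOn_of_continuousOn_closure hΩ
      (((hslice s hs).sub (hslice t ht)).const_smul (s - t)⁻¹)).aestronglyMeasurable
  · filter_upwards [hmem] with s hs
    refine (ae_restrict_iff' hΩm).2 (Eventually.of_forall fun x hx => ?_)
    -- By the mean value inequality, the bound `M` on the time derivative dominates all difference
    -- quotients.
    have h1 := (convex_Icc 0 T).norm_image_sub_le_of_norm_hasDerivWithin_le
      (fun s hs => (hasDerivWithinAt_time hT hf (subset_closure hx) hs).1)
      (fun s hs => hM (x, s) ⟨subset_closure hx, hs⟩) ht hs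
    rw [slope_def_module, norm_smul, norm_inv]
    have hM0 : 0 ≤ M := (norm_nonneg _).trans (hM (x, t) ⟨subset_closure hx, ht⟩)
    rcases eq_or_ne s t with rfl | hst
    · simpa using hM0
    · rw [inv_mul_le_iff₀ (norm_pos_iff.2 (sub_ne_zero.2 hst)), mul_comm]
      exact h1
  · exact integrable_const_iff.2 (Or.inr (by
      refine ⟨?_⟩
      rw [Measure.restrict_apply_univ]
      exact hΩ.isBounded.measure_lt_top))
  · refine (ae_restrict_iff' hΩm).2 (Eventually.of_forall fun x hx => ?_)
    exact hasDerivWithinAt_iff_tendsto_slope.1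
      (hasDerivWithinAt_time hT hf (subset_closure hx) ht).1

theorem eqOn_spaceTime_of_eqOn {f g : Plane × ℝ → ℝ} (hT : 0 < T)
    (hf : ContinuousOn f (closure Ω ×ˢ Icc 0 T)) (hg : ContinuousOn g (closure Ω ×ˢ Icc 0 T))
    (h : ∀ x ∈ Ω, ∀ t ∈ Ioo 0 T, f (x, t) = g (x, t)) : EqOn f g (closure Ω ×ˢ Icc 0 T) := by
  refine EqOn.of_subset_closure (s := Ω ×ˢ Ioo 0 T) (fun p hp => h p.1 hp.1 p.2 hp.2) hf hg
    (prod_mono subset_closure Ioo_subset_Icc_self) ?_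
  rw [closure_prod_eq, closure_Ioo hT.ne]

theorem eqOn_time_of_eqOn {X : Type*} [TopologicalSpace X] [T2Space X] {f g : ℝ → X} (hT : 0 < T)
    (hf : ContinuousOn f (Icc 0 T)) (hg : ContinuousOn g (Icc 0 T))
    (h : ∀ t ∈ Ioo 0 T, f t = g t) : ∀ t ∈ Icc 0 T, f t = g t := by
  refine EqOn.of_subset_closure (s := Ioo 0 T) h hf hg Ioo_subset_Icc_self ?_
  rw [closure_Ioo hT.ne]

end SpaceTime

/-! ### Solutions up to the boundary and up to the initial and final times -/

section Solution

variable {ρ μ g T c₀ : ℝ} {Ω ΓD ΓS ΓT : Set Plane} {ζ : Plane → ℝ} {φ : Plane → ℝ → ℝ}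
  {u : Plane → ℝ → Plane}

theorem IsSolution.contDiffOn_velocity (h : IsSolution ρ μ g T Ω ζ φ u) (i : Fin 2) :
    ContDiffOn ℝ 2 (fun p : Plane × ℝ => u p.1 p.2 i) (closure Ω ×ˢ Icc 0 T) :=
  (EuclideanSpace.proj i : Plane →L[ℝ] ℝ).contDiff.comp_contDiffOn h.smooth_u

theorem IsSolution.contDiffOn_velocity_one (h : IsSolution ρ μ g T Ω ζ φ u) (i : Fin 2) :
    ContDiffOn ℝ 1 (fun p : Plane × ℝ => u p.1 p.2 i) (closure Ω ×ˢ Icc 0 T) :=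
  (h.contDiffOn_velocity i).of_le (by norm_num)

theorem IsSolution.contDiffOn_strainRate (h : IsSolution ρ μ g T Ω ζ φ u)
    (hΩ : IsBoundedLipschitzDomain Ω) (hT : 0 < T) (i j : Fin 2) :
    ContDiffOn ℝ 1 (fun p : Plane × ℝ => strainRate Ω (fun y => u y p.2) p.1 i j)
      (closure Ω ×ˢ Icc 0 T) :=
  ((contDiffOn_pderiv hΩ hT (h.contDiffOn_velocity i) j).add
    (contDiffOn_pderiv hΩ hT (h.contDiffOn_velocity j) i)).div_const 2

theorem IsSolution.contDiffOn_stress (h : IsSolution ρ μ g T Ω ζ φ u)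
    (hΩ : IsBoundedLipschitzDomain Ω) (hT : 0 < T) (i j : Fin 2) :
    ContDiffOn ℝ 1 (fun p : Plane × ℝ => φ p.1 p.2 * strainRate Ω (fun y => u y p.2) p.1 i j)
      (closure Ω ×ˢ Icc 0 T) :=
  h.smooth_φ.mul (h.contDiffOn_strainRate hΩ hT i j)

theorem IsSolution.contDiffOn_elevation (h : IsSolution ρ μ g T Ω ζ φ u)
    (hζ : ContDiffOn ℝ 1 ζ (closure Ω)) :
    ContDiffOn ℝ 1 (fun p : Plane × ℝ => elevation φ ζ p.1 p.2) (closure Ω ×ˢ Icc 0 T) :=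
  h.smooth_φ.sub (hζ.comp contDiff_fst.contDiffOn fun _ hp => hp.1)

theorem IsSolution.contDiffOn_momentum (h : IsSolution ρ μ g T Ω ζ φ u) (i : Fin 2) :
    ContDiffOn ℝ 1 (fun p : Plane × ℝ => φ p.1 p.2 * u p.1 p.2 i) (closure Ω ×ˢ Icc 0 T) :=
  h.smooth_φ.mul (h.contDiffOn_velocity_one i)

/-- The left side is continuous on the closed cylinder and vanishes on the dense subset `Ω × (0,T)`.
The derivative within `[0,T]` is the one needed at the end times. -/
theorem IsSolution.mass_closed (h : IsSolution ρ μ g T Ω ζ φ u)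
    (hΩ : IsBoundedLipschitzDomain Ω) (hT : 0 < T) {x : Plane} (hx : x ∈ closure Ω) {t : ℝ}
    (ht : t ∈ Icc 0 T) :
    derivWithin (fun s => φ x s) (Icc 0 T) t + ∑ j, pderiv Ω j (fun y => φ y t * u y t j) x = 0 := by
  have hc : ContinuousOn (fun p : Plane × ℝ => derivWithin (fun s => φ p.1 s) (Icc 0 T) p.2 +
      ∑ j, pderiv Ω j (fun y => φ y p.2 * u y p.2 j) p.1) (closure Ω ×ˢ Icc 0 T) :=
    (continuousOn_derivWithin_time hΩ hT h.smooth_φ).add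
      (continuousOn_finsetSum _ fun j _ => continuousOn_pderiv hΩ hT (h.contDiffOn_momentum j) j)
  refine eqOn_spaceTime_of_eqOn hT hc (g := fun _ => 0) continuousOn_const (fun x hx t ht => ?_)
    (show (x, t) ∈ closure Ω ×ˢ Icc 0 T from ⟨hx, ht⟩)
  dsimp only
  rw [derivWithin_of_mem_nhds (Icc_mem_nhds ht.1 ht.2)]
  exact h.mass x hx t ht

theorem IsSolution.momentum_closed (h : IsSolution ρ μ g T Ω ζ φ u)
    (hΩ : IsBoundedLipschitzDomain Ω) (hT : 0 < T) (hζ : ContDiffOn ℝ 1 ζ (closure Ω)) {x : Plane}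
    (hx : x ∈ closure Ω) {t : ℝ} (ht : t ∈ Icc 0 T) (i : Fin 2) :
    ρ * φ x t * (derivWithin (fun s => u x s i) (Icc 0 T) t +
        ∑ j, u x t j * pderiv Ω j (fun y => u y t i) x)
      - 2 * μ * ∑ j, pderiv Ω j (fun y => φ y t * strainRate Ω (fun z => u z t) y i j) x
      + ρ * g * φ x t * pderiv Ω i (fun y => elevation φ ζ y t) x = 0 := by
  have hφc := h.smooth_φ.continuousOn
  have hc : ContinuousOn (fun p : Plane × ℝ => ρ * φ p.1 p.2 *
      (derivWithin (fun s => u p.1 s i) (Icc 0 T) p.2 +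
        ∑ j, u p.1 p.2 j * pderiv Ω j (fun y => u y p.2 i) p.1)
      - 2 * μ * ∑ j, pderiv Ω j (fun y => φ y p.2 * strainRate Ω (fun z => u z p.2) y i j) p.1
      + ρ * g * φ p.1 p.2 * pderiv Ω i (fun y => elevation φ ζ y p.2) p.1)
      (closure Ω ×ˢ Icc 0 T) := by
    refine (((continuousOn_const.mul hφc).mul
      ((continuousOn_derivWithin_time hΩ hT (h.contDiffOn_velocity_one i)).add
        (continuousOn_finsetSum _ fun j _ => ?_))).sub
      (continuousOn_const.mul (continuousOn_finsetSum _ fun j _ => ?_))).add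
      ((continuousOn_const.mul hφc).mul
        (continuousOn_pderiv hΩ hT (h.contDiffOn_elevation hζ) i))
    · exact (h.contDiffOn_velocity j).continuousOn.mul
        (continuousOn_pderiv hΩ hT (h.contDiffOn_velocity_one i) j)
    · exact continuousOn_pderiv hΩ hT (h.contDiffOn_stress hΩ hT i j) j
  refine eqOn_spaceTime_of_eqOn hT hc (g := fun _ => 0) continuousOn_const (fun x hx t ht => ?_)
    (show (x, t) ∈ closure Ω ×ˢ Icc 0 T from ⟨hx, ht⟩)
  dsimp only
  rw [derivWithin_of_mem_nhds (Icc_mem_nhds ht.1 ht.2)]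
  exact h.momentum x hx t ht i

theorem SatisfiesBoundaryConditions.dirichlet_closed
    (h : SatisfiesBoundaryConditions g T c₀ Ω ΓD ΓS ΓT ζ φ u) (hs : IsSolution ρ μ g T Ω ζ φ u)
    (hT : 0 < T) {x : Plane} (hx : x ∈ ΓD) (hxΩ : x ∈ closure Ω) {t : ℝ} (ht : t ∈ Icc 0 T) :
    u x t = 0 :=
  eqOn_time_of_eqOn (f := u x) (g := fun _ => 0) hT (continuousOn_time hs.smooth_u.continuousOn hxΩ)
    continuousOn_const (h.dirichlet x hx) t ht

theorem SatisfiesBoundaryConditions.slip_closed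
    (h : SatisfiesBoundaryConditions g T c₀ Ω ΓD ΓS ΓT ζ φ u) (hs : IsSolution ρ μ g T Ω ζ φ u)
    (hΩ : IsBoundedLipschitzDomain Ω)
    (hT : 0 < T) {x : Plane} (hx : x ∈ ΓS) (hxΩ : x ∈ closure Ω) {t : ℝ} (ht : t ∈ Icc 0 T)
    {n : Plane} (hn : IsOutwardUnitNormal Ω x n) :
    cross (apply (strainRate Ω (fun y => u y t) x) n) n = 0 ∧ inner ℝ (u x t) n = 0 := by
  have hD : ∀ i j, ContinuousOn (fun t => strainRate Ω (fun y => u y t) x i j) (Icc 0 T) :=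
    fun i j => continuousOn_time (hs.contDiffOn_strainRate hΩ hT i j).continuousOn hxΩ
  have hu : ContinuousOn (fun t => u x t) (Icc 0 T) := continuousOn_time hs.smooth_u.continuousOn hxΩ
  constructor
  · refine eqOn_time_of_eqOn (f := fun t => cross (apply (strainRate Ω (fun y => u y t) x) n) n)
      (g := fun _ => 0) hT ?_ continuousOn_const (fun t ht => (h.slip x hx t ht n hn).1) t ht
    simp only [cross, apply, Matrix.mulVec, dotProduct, Fin.sum_univ_two]
    have := hD 0 0; have := hD 0 1; have := hD 1 0; have := hD 1 1
    fun_prop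
  · exact eqOn_time_of_eqOn (f := fun t => inner ℝ (u x t) n)
      (g := fun _ => 0) hT (by fun_prop) continuousOn_const
      (fun t ht => (h.slip x hx t ht n hn).2) t ht

/-- Positivity of `φ` keeps the quotient `η/φ` continuous up to the end times. -/
theorem SatisfiesBoundaryConditions.transmission_closed
    (h : SatisfiesBoundaryConditions g T c₀ Ω ΓD ΓS ΓT ζ φ u) (hs : IsSolution ρ μ g T Ω ζ φ u)
    (hT : 0 < T) {x : Plane} (hx : x ∈ ΓT) (hxΩ : x ∈ closure Ω)
    (hφ : ∀ t ∈ Icc 0 T, 0 < φ x t) {t : ℝ} (ht : t ∈ Icc 0 T)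
    {n : Plane} (hn : IsOutwardUnitNormal Ω x n) :
    u x t = (c₀ * √(g * ζ x) * (elevation φ ζ x t / φ x t)) • n := by
  have hu : ContinuousOn (fun t => u x t) (Icc 0 T) := continuousOn_time hs.smooth_u.continuousOn hxΩ
  have hφc : ContinuousOn (fun t => φ x t) (Icc 0 T) :=
    continuousOn_time hs.smooth_φ.continuousOn hxΩ
  refine eqOn_time_of_eqOn (f := fun t => u x t)
    (g := fun t => (c₀ * √(g * ζ x) * (elevation φ ζ x t / φ x t)) • n) hT hu ?_
    (fun t ht => h.transmission x hx t ht n hn) t ht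
  exact (continuousOn_const.mul ((hφc.sub continuousOn_const).div hφc
    fun t ht => (hφ t ht).ne')).smul continuousOn_const

end Solution


/-! ### The energy balance -/

section Energy

variable {ρ μ g T c₀ : ℝ} {Ω ΓD ΓS ΓT : Set Plane} {ζ : Plane → ℝ} {φ : Plane → ℝ → ℝ}
  {u : Plane → ℝ → Plane}

theorem norm_sq_plane (a : Plane) : ‖a‖ ^ 2 = a 0 ^ 2 + a 1 ^ 2 := by
  rw [← real_inner_self_eq_norm_sq, inner_plane]; ring

theorem contDiffOn_plane {n : WithTop ℕ∞} {s : Set Plane} {G : Plane → Plane}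
    (h : ∀ i, ContDiffOn ℝ n (fun y => G y i) s) : ContDiffOn ℝ n G s := by
  exact (contDiffOn_piLp 2).2 h

/-- The flux `φ|u|²u` of kinetic energy. -/
noncomputable def kineticFlux (φ : Plane → ℝ → ℝ) (u : Plane → ℝ → Plane) (t : ℝ) (y : Plane) :
    Plane :=
  (φ y t * ‖u y t‖ ^ 2) • u y t

/-- The flux `φηu` of potential energy. -/
noncomputable def potentialFlux (φ : Plane → ℝ → ℝ) (ζ : Plane → ℝ) (u : Plane → ℝ → Plane) (t : ℝ)
    (y : Plane) : Plane :=
  (φ y t * elevation φ ζ y t) • u y t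

/-- The flux `φD(u)u` of energy due to viscosity. -/
noncomputable def viscousFlux (Ω : Set Plane) (φ : Plane → ℝ → ℝ) (u : Plane → ℝ → Plane) (t : ℝ)
    (y : Plane) : Plane :=
  φ y t • apply (strainRate Ω (fun z => u z t) y) (u y t)

/-- The total flux of energy into `Ω`. -/
noncomputable def energyFlux (ρ μ g : ℝ) (Ω : Set Plane) (ζ : Plane → ℝ) (φ : Plane → ℝ → ℝ)
    (u : Plane → ℝ → Plane) (t : ℝ) (y : Plane) : Plane :=
  (-(ρ / 2)) • kineticFlux φ u t y + (-(ρ * g)) • potentialFlux φ ζ u t y +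
    (2 * μ) • viscousFlux Ω φ u t y

/-- The rate of viscous dissipation `2μφ|D(u)|²`. -/
noncomputable def dissipation (μ : ℝ) (Ω : Set Plane) (φ : Plane → ℝ → ℝ) (u : Plane → ℝ → Plane)
    (t : ℝ) (y : Plane) : ℝ :=
  2 * μ * (φ y t * ∑ i, ∑ j, strainRate Ω (fun z => u z t) y i j ^ 2)

theorem strainRate_symm (v : Plane → Plane) (x : Plane) (i j : Fin 2) :
    strainRate Ω v x i j = strainRate Ω v x j i := by
  rw [strainRate, strainRate, add_comm]

theorem inner_apply_strainRate (v : Plane → Plane) (x a b : Plane) :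
    inner ℝ (apply (strainRate Ω v x) a) b = inner ℝ (apply (strainRate Ω v x) b) a := by
  simp only [inner_plane, apply, Matrix.mulVec, dotProduct, Fin.sum_univ_two]
  rw [strainRate_symm v x 1 0]
  ring

theorem IsSolution.contDiffOn_kineticFlux (h : IsSolution ρ μ g T Ω ζ φ u) {t : ℝ}
    (ht : t ∈ Icc 0 T) : ContDiffOn ℝ 1 (kineticFlux φ u t) (closure Ω) := by
  have hu := contDiffOn_slice (h.smooth_u.of_le (by norm_num : (1 : WithTop ℕ∞) ≤ 2)) ht
  exact ((contDiffOn_slice h.smooth_φ ht).mul (hu.norm_sq ℝ)).smul hu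

theorem IsSolution.contDiffOn_potentialFlux (h : IsSolution ρ μ g T Ω ζ φ u)
    (hζ : ContDiffOn ℝ 1 ζ (closure Ω)) {t : ℝ}
    (ht : t ∈ Icc 0 T) : ContDiffOn ℝ 1 (potentialFlux φ ζ u t) (closure Ω) := by
  have hu := contDiffOn_slice (h.smooth_u.of_le (by norm_num : (1 : WithTop ℕ∞) ≤ 2)) ht
  exact ((contDiffOn_slice h.smooth_φ ht).mul
    (contDiffOn_slice (h.contDiffOn_elevation hζ) ht)).smul hu

theorem IsSolution.contDiffOn_viscousFlux (h : IsSolution ρ μ g T Ω ζ φ u)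
    (hΩ : IsBoundedLipschitzDomain Ω) (hT : 0 < T) {t : ℝ}
    (ht : t ∈ Icc 0 T) : ContDiffOn ℝ 1 (viscousFlux Ω φ u t) (closure Ω) := by
  refine (contDiffOn_slice h.smooth_φ ht).smul (contDiffOn_plane fun i => ?_)
  simp only [apply, Matrix.mulVec, dotProduct]
  exact ContDiffOn.sum fun j _ => (contDiffOn_slice (h.contDiffOn_strainRate hΩ hT i j) ht).mul
    (contDiffOn_slice (h.contDiffOn_velocity_one j) ht)

theorem IsSolution.contDiffOn_energyFlux (h : IsSolution ρ μ g T Ω ζ φ u)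
    (hΩ : IsBoundedLipschitzDomain Ω) (hT : 0 < T) (hζ : ContDiffOn ℝ 1 ζ (closure Ω)) {t : ℝ}
    (ht : t ∈ Icc 0 T) : ContDiffOn ℝ 1 (energyFlux ρ μ g Ω ζ φ u t) (closure Ω) :=
  (((h.contDiffOn_kineticFlux ht).const_smul _).add
    ((h.contDiffOn_potentialFlux hζ ht).const_smul _)).add
    ((h.contDiffOn_viscousFlux hΩ hT ht).const_smul _)

/-- Here `a, b` are the velocity components, `m = φu_j`, and `p, q` are `φD_{0j}, φD_{1j}`. These
products stay unexpanded because the equations contain exactly their derivatives. -/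
theorem pderiv_flux_component (hΩ : IsBoundedLipschitzDomain Ω) {x : Plane} (hx : x ∈ closure Ω)
    {a b η m p q : Plane → ℝ} (ha : DifferentiableWithinAt ℝ a (closure Ω) x)
    (hb : DifferentiableWithinAt ℝ b (closure Ω) x) (hη : DifferentiableWithinAt ℝ η (closure Ω) x)
    (hm : DifferentiableWithinAt ℝ m (closure Ω) x) (hp : DifferentiableWithinAt ℝ p (closure Ω) x)
    (hq : DifferentiableWithinAt ℝ q (closure Ω) x) (j : Fin 2) :
    pderiv Ω j (fun y => -(ρ / 2) * ((a y * a y + b y * b y) * m y) + -(ρ * g) * (η y * m y)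
      + 2 * μ * (a y * p y + b y * q y)) x =
    -(ρ / 2) * ((2 * a x * pderiv Ω j a x + 2 * b x * pderiv Ω j b x) * m x
      + (a x ^ 2 + b x ^ 2) * pderiv Ω j m x)
    - ρ * g * (pderiv Ω j η x * m x + η x * pderiv Ω j m x)
    + 2 * μ * (pderiv Ω j a x * p x + a x * pderiv Ω j p x + pderiv Ω j b x * q x
      + b x * pderiv Ω j q x) := by
  have ha := ha.hasFDerivWithinAt
  have hb := hb.hasFDerivWithinAt
  have hη := hη.hasFDerivWithinAt
  have hm := hm.hasFDerivWithinAt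
  have hp := hp.hasFDerivWithinAt
  have hq := hq.hasFDerivWithinAt
  have h := (((((ha.mul ha).add (hb.mul hb)).mul hm).const_mul (-(ρ / 2))).add
    ((hη.mul hm).const_mul (-(ρ * g)))).add (((ha.mul hp).add (hb.mul hq)).const_mul (2 * μ))
  have h2 : fderivWithin ℝ (fun y => -(ρ / 2) * ((a y * a y + b y * b y) * m y)
      + -(ρ * g) * (η y * m y) + 2 * μ * (a y * p y + b y * q y)) (closure Ω) x = _ :=
    h.fderivWithin (hΩ.uniqueDiffOn x hx)
  rw [pderiv, h2]
  simp [pderiv]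
  ring

/-- The multiplier `ρ|u|²/2` completes the inertial terms to derivatives of the kinetic energy and
its flux, and `ρgη` does so for gravity. The viscous term leaves `φ D(u):∇u`, which is `φ|D(u)|²` by
symmetry of `D(u)`. -/
theorem IsSolution.energy_density_balance (h : IsSolution ρ μ g T Ω ζ φ u)
    (hΩ : IsBoundedLipschitzDomain Ω) (hT : 0 < T) (hζ : ContDiffOn ℝ 1 ζ (closure Ω)) {x : Plane}
    (hx : x ∈ closure Ω) {t : ℝ} (ht : t ∈ Icc 0 T) :
    derivWithin (fun s => ρ / 2 * φ x s * ‖u x s‖ ^ 2) (Icc 0 T) t +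
      derivWithin (fun s => ρ * g * |elevation φ ζ x s| ^ 2 / 2) (Icc 0 T) t =
    divergence Ω (energyFlux ρ μ g Ω ζ φ u t) x - dissipation μ Ω φ u t x := by
  have hut := uniqueDiffOn_Icc hT t ht
  have hdφ := (hasDerivWithinAt_time hT h.smooth_φ hx ht).1
  have hdu := fun i => (hasDerivWithinAt_time hT (h.contDiffOn_velocity_one i) hx ht).1
  have h1 : derivWithin (fun s => ρ / 2 * φ x s * ‖u x s‖ ^ 2) (Icc 0 T) t =
      ρ / 2 * derivWithin (fun s => φ x s) (Icc 0 T) t * (u x t 0 ^ 2 + u x t 1 ^ 2)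
      + ρ * φ x t * (u x t 0 * derivWithin (fun s => u x s 0) (Icc 0 T) t +
        u x t 1 * derivWithin (fun s => u x s 1) (Icc 0 T) t) := by
    simp only [norm_sq_plane]
    have := ((hdφ.const_mul (ρ / 2)).mul (((hdu 0).pow 2).add ((hdu 1).pow 2))).derivWithin hut
    refine Eq.trans this ?_
    simp
    ring
  have h2 : derivWithin (fun s => ρ * g * |elevation φ ζ x s| ^ 2 / 2) (Icc 0 T) t =
      ρ * g * elevation φ ζ x t * derivWithin (fun s => φ x s) (Icc 0 T) t := by
    simp only [sq_abs]
    have := ((((hdφ.sub_const (ζ x)).pow 2).const_mul (ρ * g)).div_const 2).derivWithin hut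
    refine Eq.trans this ?_
    simp [elevation]
    ring
  have hcomp : ∀ j : Fin 2, (fun y => energyFlux ρ μ g Ω ζ φ u t y j) = fun y =>
      -(ρ / 2) * ((u y t 0 * u y t 0 + u y t 1 * u y t 1) * (φ y t * u y t j))
      + -(ρ * g) * (elevation φ ζ y t * (φ y t * u y t j))
      + 2 * μ * (u y t 0 * (φ y t * strainRate Ω (fun z => u z t) y 0 j) +
        u y t 1 * (φ y t * strainRate Ω (fun z => u z t) y 1 j)) := by
    intro j
    funext y
    simp only [energyFlux, kineticFlux, potentialFlux, viscousFlux, norm_sq_plane, PiLp.add_apply,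
      PiLp.smul_apply, smul_eq_mul, apply, Matrix.mulVec, dotProduct, Fin.sum_univ_two]
    rw [strainRate_symm _ y j 0, strainRate_symm _ y j 1]
    ring
  have hdiff : ∀ {f : Plane × ℝ → ℝ}, ContDiffOn ℝ 1 f (closure Ω ×ˢ Icc 0 T) →
      DifferentiableWithinAt ℝ (fun y => f (y, t)) (closure Ω) x := fun hf =>
    (contDiffOn_slice hf ht).differentiableOn one_ne_zero x hx
  have hdiv := fun j => pderiv_flux_component (ρ := ρ) (μ := μ) (g := g) hΩ hx
    (hdiff (h.contDiffOn_velocity_one 0)) (hdiff (h.contDiffOn_velocity_one 1))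
    (hdiff (h.contDiffOn_elevation hζ)) (hdiff (h.contDiffOn_momentum j))
    (hdiff (h.contDiffOn_stress hΩ hT 0 j)) (hdiff (h.contDiffOn_stress hΩ hT 1 j)) j
  have hmass := h.mass_closed hΩ hT hx ht
  have hmom := h.momentum_closed hΩ hT hζ hx ht
  have hmom0 := hmom 0
  have hmom1 := hmom 1
  have hs : ∀ i j, strainRate Ω (fun z => u z t) x i j =
    (pderiv Ω j (fun y => u y t i) x + pderiv Ω i (fun y => u y t j) x) / 2 := fun i j => rfl
  rw [h1, h2, divergence, dissipation, Fin.sum_univ_two, hcomp 0, hcomp 1, hdiv 0, hdiv 1]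
  simp only [Fin.sum_univ_two] at hmass hmom0 hmom1 ⊢
  simp only [hs 0 0, hs 0 1, hs 1 0, hs 1 1]
  linear_combination (ρ / 2 * (u x t 0 ^ 2 + u x t 1 ^ 2) + ρ * g * elevation φ ζ x t) * hmass
    + u x t 0 * hmom0 + u x t 1 * hmom1

theorem IsSolution.hasDerivWithinAt_energy (h : IsSolution ρ μ g T Ω ζ φ u)
    (hΩ : IsBoundedLipschitzDomain Ω) (hT : 0 < T) (hζ : ContDiffOn ℝ 1 ζ (closure Ω)) {t : ℝ}
    (ht : t ∈ Icc 0 T) :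
    HasDerivWithinAt (energy ρ g Ω ζ φ u)
      (lineIntegral (frontier Ω)
        (fun y => inner ℝ (energyFlux ρ μ g Ω ζ φ u t y) (outwardNormal Ω y))
        - ∫ x in Ω, dissipation μ Ω φ u t x) (Icc 0 T) t := by
  have hu1 := h.smooth_u.of_le (by norm_num : (1 : WithTop ℕ∞) ≤ 2)
  have hk : ContDiffOn ℝ 1 (fun p : Plane × ℝ => ρ / 2 * φ p.1 p.2 * ‖u p.1 p.2‖ ^ 2)
      (closure Ω ×ˢ Icc 0 T) := (contDiffOn_const.mul h.smooth_φ).mul (hu1.norm_sq ℝ)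
  have hp : ContDiffOn ℝ 1 (fun p : Plane × ℝ => ρ * g * |elevation φ ζ p.1 p.2| ^ 2 / 2)
      (closure Ω ×ˢ Icc 0 T) := by
    simp only [sq_abs]
    exact (contDiffOn_const.mul ((h.contDiffOn_elevation hζ).pow 2)).div_const 2
  have hslice : ∀ {f : Plane × ℝ → ℝ}, ContinuousOn f (closure Ω ×ˢ Icc 0 T) →
      IntegrableOn (fun y => f (y, t)) Ω := fun hf =>
    integrableOn_of_continuousOn_closure hΩ
      (hf.comp (f := fun y : Plane => (y, t)) (by fun_prop) fun _ hy => ⟨hy, ht⟩)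
  have hik := hslice (continuousOn_derivWithin_time hΩ hT hk)
  have hip := hslice (continuousOn_derivWithin_time hΩ hT hp)
  have hid : IntegrableOn (dissipation μ Ω φ u t) Ω := by
    have hc : ContinuousOn (fun p : Plane × ℝ => dissipation μ Ω φ u p.2 p.1)
        (closure Ω ×ˢ Icc 0 T) :=
      continuousOn_const.mul (h.smooth_φ.continuousOn.mul (continuousOn_finsetSum _ fun i _ =>
        continuousOn_finsetSum _ fun j _ =>
          (h.contDiffOn_strainRate hΩ hT i j).continuousOn.pow 2))
    exact hslice hc
  have hd := (hasDerivWithinAt_integral hΩ hT hk ht).add (hasDerivWithinAt_integral hΩ hT hp ht)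
  refine HasDerivWithinAt.congr_deriv hd ?_
  dsimp only at hik hip ⊢
  have hikp := hik.add hip
  simp only [Pi.add_def] at hikp
  rw [← integral_add hik hip,
    ← (hΩ.divergence_theorem (h.contDiffOn_energyFlux hΩ hT hζ ht)).2, eq_sub_iff_add_eq,
    ← integral_add hikp hid]
  refine setIntegral_congr_fun hΩ.isOpen.measurableSet fun x hx => ?_
  have := h.energy_density_balance hΩ hT hζ (subset_closure hx) ht
  linarith

theorem dissipation_nonneg (hμ : 0 < μ) {t : ℝ} {x : Plane} (hφ : 0 ≤ φ x t) :
    0 ≤ dissipation μ Ω φ u t x := by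
  unfold dissipation
  positivity

/-! ### The boundary terms -/

/-- Where no normal exists the value `0` kills every boundary integrand, so pointwise arguments need
no exceptional null set. -/
theorem outwardNormal_cases (Ω : Set Plane) (x : Plane) :
    outwardNormal Ω x = 0 ∨ IsOutwardUnitNormal Ω x (outwardNormal Ω x) := by
  by_cases hex : ∃ ν, IsOutwardUnitNormal Ω x ν
  · obtain ⟨ν, hν⟩ := hex
    rw [outwardNormal_eq hν]; exact Or.inr hν
  · rw [outwardNormal, dif_neg hex]; exact Or.inl rfl

theorem inner_kineticFlux (t : ℝ) (y n : Plane) :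
    inner ℝ (kineticFlux φ u t y) n = φ y t * ‖u y t‖ ^ 2 * inner ℝ (u y t) n :=
  real_inner_smul_left _ _ _

theorem inner_potentialFlux (t : ℝ) (y n : Plane) :
    inner ℝ (potentialFlux φ ζ u t y) n = φ y t * elevation φ ζ y t * inner ℝ (u y t) n :=
  real_inner_smul_left _ _ _

theorem inner_viscousFlux (t : ℝ) (y n : Plane) :
    inner ℝ (viscousFlux Ω φ u t y) n =
      φ y t * inner ℝ (apply (strainRate Ω (fun y => u y t) y) n) (u y t) := by
  rw [viscousFlux, real_inner_smul_left, inner_apply_strainRate]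

theorem inner_energyFlux (t : ℝ) (y n : Plane) :
    inner ℝ (energyFlux ρ μ g Ω ζ φ u t y) n =
      -(ρ / 2) * (φ y t * ‖u y t‖ ^ 2 * inner ℝ (u y t) n)
      + -(ρ * g) * (φ y t * elevation φ ζ y t * inner ℝ (u y t) n)
      + 2 * μ * (φ y t * inner ℝ (apply (strainRate Ω (fun y => u y t) y) n) (u y t)) := by
  rw [energyFlux, inner_add_left, inner_add_left, real_inner_smul_left, real_inner_smul_left,
    real_inner_smul_left, inner_kineticFlux, inner_potentialFlux, inner_viscousFlux]

/-- In the plane `a` is parallel to `n` and `v` is orthogonal to it. On `ΓS` this removes the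
viscous flux. -/
theorem inner_eq_zero_of_cross_eq_zero {a n v : Plane} (hn : ‖n‖ = 1) (hc : cross a n = 0)
    (hv : inner ℝ v n = 0) : inner ℝ a v = 0 := by
  have h1 : n 0 ^ 2 + n 1 ^ 2 = 1 := by rw [← norm_sq_plane, hn, one_pow]
  rw [inner_plane] at hv ⊢
  rw [cross] at hc
  linear_combination (a 0 * n 0 + a 1 * n 1) * hv - (a 0 * v 0 + a 1 * v 1) * h1
    + (v 0 * n 1 - v 1 * n 0) * hc

theorem lineIntegral_frontier_eq (hΓ : IsBoundaryDecomposition Ω ΓD ΓS ΓT) {q : Plane → ℝ}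
    (hD : ∀ x ∈ ΓD, q x = 0)
    (hS : ∀ x ∈ ΓS, q x = 0) : lineIntegral (frontier Ω) q = lineIntegral ΓT q := by
  unfold lineIntegral
  have hae : (frontier Ω : Set Plane) =ᵐ[Measure.hausdorffMeasure 1] (ΓD ∪ ΓS ∪ ΓT : Set Plane) := by
    refine EventuallyLE.antisymm ?_ ?_
    · exact ae_le_set.2 hΓ.null_rest
    · exact LE.le.eventuallyLE
        (union_subset (union_subset hΓ.subset_D hΓ.subset_S) hΓ.subset_T)
  rw [setIntegral_congr_set hae]
  refine setIntegral_eq_of_subset_of_forall_sdiff_eq_zero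
    ((hΓ.measurable_D.union hΓ.measurable_S).union hΓ.measurable_T) subset_union_right ?_
  rintro x ⟨(hx | hx) | hx, hxT⟩
  · exact hD x hx
  · exact hS x hx
  · exact absurd hx hxT

theorem transmission_flux_nonpos {α c P H z k : ℝ} (hρ : 0 < ρ) (hg : 0 < g) (hα : α ∈ Ioo (0 : ℝ) 1)
    (hc₀ : 0 < c₀) (hc₀' : c₀ ≤ √(2 / α) * (1 - α)) (hz : 0 < z) (hP : 0 < P) (hH : H = P - z)
    (hHα : -α * z ≤ H) (hc : c = c₀ * √(g * z)) (hk : k = c * (H / P)) :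
    -(ρ / 2) * (P * k ^ 2 * k) + -(ρ * g) * (P * H * k) ≤ 0 := by
  have hc0 : 0 ≤ c := by rw [hc]; positivity
  have hcsq : c ^ 2 = c₀ ^ 2 * (g * z) := by rw [hc, mul_pow, Real.sq_sqrt (by positivity)]
  have hPk : P * k = c * H := by rw [hk]; field_simp
  have hc₀sq : α * c₀ ^ 2 ≤ 2 * (1 - α) ^ 2 := by
    have h1 : c₀ ^ 2 ≤ (√(2 / α) * (1 - α)) ^ 2 := by gcongr
    have h0 : (0 : ℝ) ≤ 2 / α := div_nonneg zero_le_two hα.1.le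
    rw [mul_pow, Real.sq_sqrt h0] at h1
    have h2 := mul_le_mul_of_nonneg_left h1 hα.1.le
    have h3 : α * (2 / α * (1 - α) ^ 2) = 2 * (1 - α) ^ 2 := by
      have := hα.1.ne'
      field_simp
    linarith
  -- The only place where the bounds on `H` and `c₀` matter: for `H < 0` one has `P ≥ (1 - α)z` and
  -- `c²H ≥ -αc₀²gz²`.
  have key : 0 ≤ c ^ 2 * H + 2 * (g * P ^ 2) := by
    rcases le_or_gt 0 H with h0 | h0
    · positivity
    · have h1 : (1 - α) * z ≤ P := by linarith
      have h2 : ((1 - α) * z) ^ 2 ≤ P ^ 2 := by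
        have : 0 ≤ (1 - α) * z := mul_nonneg (by linarith [hα.2]) hz.le
        gcongr
      have h3 : c ^ 2 * (-α * z) ≤ c ^ 2 * H := by gcongr
      have h4 : α * c₀ ^ 2 * (g * z ^ 2) ≤ 2 * (1 - α) ^ 2 * (g * z ^ 2) := by gcongr
      have h5 : g * ((1 - α) * z) ^ 2 ≤ g * P ^ 2 := by gcongr
      rw [hcsq] at h3 ⊢
      nlinarith
  -- Multiplying by `P²` clears the denominators, since `Pk = cH`.
  have hmul : P ^ 2 * (-(ρ / 2) * (P * k ^ 2 * k) + -(ρ * g) * (P * H * k)) =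
      -(ρ / 2 * c * H ^ 2 * (c ^ 2 * H + 2 * (g * P ^ 2))) := by
    have : P ^ 2 * (-(ρ / 2) * (P * k ^ 2 * k) + -(ρ * g) * (P * H * k)) =
        -(ρ / 2) * (P * k) ^ 3 - ρ * g * P ^ 2 * H * (P * k) := by ring
    rw [this, hPk]; ring
  have hP2 : 0 < P ^ 2 := by positivity
  have hn : 0 ≤ ρ / 2 * c * H ^ 2 * (c ^ 2 * H + 2 * (g * P ^ 2)) := by positivity
  by_contra hcon
  rw [not_le] at hcon
  have := mul_pos hP2 hcon
  linarith

end Energy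

end SWE


/-! ### The energy inequality -/

theorem theorem2 (ρ μ g T c₀ α : ℝ) (hρ : 0 < ρ) (hμ : 0 < μ) (hg : 0 < g) (hT : 0 < T)
    (Ω ΓD ΓS ΓT : Set SWE.Plane) (hΩ : SWE.IsBoundedLipschitzDomain Ω)
    (hΓ : SWE.IsBoundaryDecomposition Ω ΓD ΓS ΓT)
    (ζ : SWE.Plane → ℝ) (hζ : ContDiffOn ℝ 1 ζ (closure Ω)) (hζ_pos : ∀ x ∈ closure Ω, 0 < ζ x)
    (φ : SWE.Plane → ℝ → ℝ) (u : SWE.Plane → ℝ → SWE.Plane)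
    (hsol : SWE.IsSolution ρ μ g T Ω ζ φ u)
    (hbc : SWE.SatisfiesBoundaryConditions g T c₀ Ω ΓD ΓS ΓT ζ φ u)
    (hφ : ∀ x ∈ closure ΓT, ∀ t ∈ Set.Icc 0 T, 0 < φ x t)
    (hα : α ∈ Set.Ioo (0 : ℝ) 1)
    (hη : ∀ x ∈ closure ΓT, ∀ t ∈ Set.Icc 0 T, -α * ζ x ≤ SWE.elevation φ ζ x t)
    (hc₀ : 0 < c₀) (hc₀' : c₀ ≤ √(2 / α) * (1 - α)) :
    ∀ t ∈ Set.Icc 0 T,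
      SWE.I₁ ρ Ω φ u t ΓT + SWE.I₂ ρ g Ω ζ φ u t ΓT ≤ 0 ∧
      DifferentiableWithinAt ℝ (SWE.energy ρ g Ω ζ φ u) (Set.Icc 0 T) t ∧
      ((∀ x ∈ Ω, 0 ≤ φ x t) →
        derivWithin (SWE.energy ρ g Ω ζ φ u) (Set.Icc 0 T) t ≤ SWE.I₃ μ Ω φ u t ΓT) := by
  intro t ht
  have hcl : ∀ {Γ : Set SWE.Plane}, Γ ⊆ frontier Ω → ∀ x ∈ Γ, x ∈ closure Ω := fun h x hx =>
    frontier_subset_closure (h hx)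
  -- Integrability of the three fluxes on `ΓT`, inherited from the whole boundary, is what allows
  -- the line integrals to be added.
  have hkin := (hΩ.divergence_theorem (hsol.contDiffOn_kineticFlux ht)).1.mono_set hΓ.subset_T
  have hpot := (hΩ.divergence_theorem (hsol.contDiffOn_potentialFlux hζ ht)).1.mono_set hΓ.subset_T
  have hvis := (hΩ.divergence_theorem (hsol.contDiffOn_viscousFlux hΩ hT ht)).1.mono_set hΓ.subset_T
  simp only [SWE.inner_kineticFlux] at hkin
  simp only [SWE.inner_potentialFlux] at hpot
  simp only [SWE.inner_viscousFlux] at hvis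
  have hsum := (hkin.const_mul (-(ρ / 2))).add (hpot.const_mul (-(ρ * g)))
  simp only [Pi.add_def] at hsum
  have hI12 : SWE.I₁ ρ Ω φ u t ΓT + SWE.I₂ ρ g Ω ζ φ u t ΓT ≤ 0 := by
    rw [SWE.I₁, SWE.I₂, SWE.lineIntegral, SWE.lineIntegral, ← integral_const_mul,
      ← integral_const_mul, ← integral_add (hkin.const_mul _) (hpot.const_mul _)]
    refine setIntegral_nonpos hΓ.measurable_T fun x hx => ?_
    rcases SWE.outwardNormal_cases Ω x with h0 | hn
    · simp [h0]
    · have hxT := subset_closure hx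
      have hxΩ := hcl hΓ.subset_T x hx
      have hu := hbc.transmission_closed hsol hT hx hxΩ (hφ x hxT) ht hn
      set k := c₀ * √(g * ζ x) * (SWE.elevation φ ζ x t / φ x t) with hk
      have hin : inner ℝ (u x t) (SWE.outwardNormal Ω x) = k := by
        rw [hu, real_inner_smul_left, real_inner_self_eq_norm_sq, hn.1]; ring
      have hnm : ‖u x t‖ ^ 2 = k ^ 2 := by
        rw [hu, norm_smul, hn.1, mul_one, Real.norm_eq_abs, sq_abs]
      rw [hin, hnm]
      exact SWE.transmission_flux_nonpos hρ hg hα hc₀ hc₀' (hζ_pos x hxΩ) (hφ x hxT t ht) rfl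
        (hη x hxT t ht) rfl hk
  have hE := hsol.hasDerivWithinAt_energy hΩ hT hζ ht
  refine ⟨hI12, hE.differentiableWithinAt, fun hφ0 => ?_⟩
  rw [hE.derivWithin (uniqueDiffOn_Icc hT t ht)]
  have hdis : 0 ≤ ∫ x in Ω, SWE.dissipation μ Ω φ u t x :=
    setIntegral_nonneg hΩ.isOpen.measurableSet fun x hx => SWE.dissipation_nonneg hμ (hφ0 x hx)
  -- Only `ΓT` contributes to the total flux; with `I₁ + I₂ ≤ 0` and nonnegative dissipation the
  -- inequality follows.
  have hflux : SWE.lineIntegral (frontier Ω)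
      (fun y => inner ℝ (SWE.energyFlux ρ μ g Ω ζ φ u t y) (SWE.outwardNormal Ω y)) =
      SWE.I₁ ρ Ω φ u t ΓT + SWE.I₂ ρ g Ω ζ φ u t ΓT + SWE.I₃ μ Ω φ u t ΓT := by
    rw [SWE.lineIntegral_frontier_eq hΓ]
    · simp only [SWE.inner_energyFlux]
      rw [SWE.I₁, SWE.I₂, SWE.I₃, SWE.lineIntegral, SWE.lineIntegral, SWE.lineIntegral,
        SWE.lineIntegral, ← integral_const_mul, ← integral_const_mul, ← integral_const_mul,
        ← integral_add (hkin.const_mul _) (hpot.const_mul _), ← integral_add hsum (hvis.const_mul _)]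
    · intro x hx
      rw [SWE.inner_energyFlux,
        hbc.dirichlet_closed hsol hT hx (hcl hΓ.subset_D x hx) ht]
      simp
    · intro x hx
      rcases SWE.outwardNormal_cases Ω x with h0 | hn
      · simp [h0]
      · obtain ⟨h1, h2⟩ := hbc.slip_closed hsol hΩ hT hx (hcl hΓ.subset_S x hx) ht hn
        rw [SWE.inner_energyFlux, h2, SWE.inner_eq_zero_of_cross_eq_zero hn.1 h1 h2]
        ring
  linarith
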